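/- Let $f_0,f_1,\dots,f_m:\mathbb R^n\to\mathbb R$ be twice continuously differentiable, $I=\{1,\dots,m\}$, $g_j=\nabla f_j$, and consider the problem (NCP) of minimizing $f_0(x)$ subject to $f_j(x)\le 0$, $j\in I$. Put $\varphi(x)=\max\{0,f_j(x):j\in I\}$; $\bar f_j(x)=f_j(x)$ if $f_j(x)\le 0$ and $\bar f_j(x)=f_j(x)-\varphi(x)$ if $f_j(x)>0$; $I(x)=\{j\in I:\bar f_j(x)=0\}$. Assume that for every $x\in\mathbb R^n$ the vectors $g_j(x)$, $j\in I(x)$, are linearly independent. Fix parameters $\gamma,\eta,\varepsilon\in(0,1)$, $0<\theta<\sigma<1$, $0<\varrho<\sigma$, $\xi,\zeta>0$, $\alpha\in(0,\tfrac12)$, $\rho>1$, $\delta>2$, $\tau\in(2,3)$. Given $x^k$ and a symmetric positive definite matrix $B_k$, write $\varphi_k=\varphi(x^k)$; an iteration of the algorithm is as follows. 1. $d_0^k$ is the minimizer of $g_0(x^k)^Td+\frac12 d^TB_kd$ subject to $\bar f_j(x^k)+g_j(x^k)^Td\le 0$, $j\in I$, and $\lambda^k\in\mathbb R^m$ is a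 corresponding KKT multiplier vector. If $d_0^k=0$ and $\varphi_k=0$, stop. 2. Let $D_j^k=|\bar f_j(x^k)|\,(|\bar f_j(x^k)+g_j(x^k)^Td_0^k|+\|d_0^k\|)$, and for $r\in\mathbb R^m$ consider the linear system $(S_r)$ in $(d,h)\in\mathbb R^n\times\mathbb R^m$: $B_kd+\sum_{j\in I}h_jg_j(x^k)=0$ and $g_j(x^k)^Td-D_j^kh_j=r_j$, $j\in I$. Let $(d_1^k,h_1^k)$ solve $(S_r)$ with $r_j=-(\|d_0^k\|^\tau+\varphi_k^\sigma)-\big(f_j(x^k+d_0^k)-f_j(x^k)-g_j(x^k)^Td_0^k\big)$, let $(\tilde d^k,\tilde h^k)$ solve $(S_r)$ with $r_j=-(\|d_0^k\|+\varphi_k^\sigma)$, and let $q^k=(1-\beta_k)d_0^k+\beta_k\tilde d^k$, where $\beta_k=1$ if $g_0(x^k)^T\tilde d^k\le g_0(x^k)^Td_0^k$, and otherwise $\beta_k=\min\Big\{1,\frac{(\theta-1)g_0(x^k)^Td_0^k+\varphi_k^\theta}{g_0(x^k)^T\tilde d^k-g_0(x^k)^Td_0^k}\Big\}$. 3. Let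 $d=d_0^k+d_1^k$. If $g_0(x^k)^Td_0^k\le\zeta\min\{-\|d_0^k\|^\delta,-\|d\|^\delta\}+\xi\varphi_k^\varrho$, and some $t\in\{1,\frac12,\frac14,\dots\}$ with $t\ge\varepsilon$ satisfies $f_0(x^k+td)\le f_0(x^k)+\alpha t\,g_0(x^k)^Td_0^k+\rho(1-\alpha)t\varphi_k^\theta$, $f_j(x^k+td)\le\varphi_k-\alpha t(\|d_0^k\|^\tau+\varphi_k^\sigma)$ for all $j\in I$ with $f_j(x^k)>0$, and $f_j(x^k+td)\le0$ for all $j\in I$ with $f_j(x^k)\le0$, then let $t_k$ be the first (largest) such $t$ and $d^k=d$. 4. Otherwise let $d^k=q^k$ and let $t_k$ be the first $t\in\{1,\eta,\eta^2,\dots\}$ with $f_0(x^k+tq^k)\le f_0(x^k)+\gamma t\,g_0(x^k)^Tq^k+\rho(1-\gamma)t\varphi_k^\theta$, $f_j(x^k+tq^k)\le\varphi_k-\gamma t\beta_k(\|d_0^k\|+\varphi_k^\sigma)$ for all $j\in I$ with $f_j(x^k)>0$, and $f_j(x^k+tq^k)\le0$ for all $j\in I$ with $f_j(x^k)\le 0$.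 5. $x^{k+1}=x^k+t_kd^k$, and $B_{k+1}$ is any symmetric positive definite matrix. Suppose that the algorithm, started at some $x^0\in\mathbb R^n$, does not stop, that there are $a,b>0$ with $a\|d\|^2\le d^TB_kd\le b\|d\|^2$ for all $d\in\mathbb R^n$ and all $k$, that $\{x^k\}$ is bounded, and that $x^*$ is an accumulation point of $\{x^k\}$ at which the strong second-order sufficient condition holds: for every KKT multiplier $\lambda$ of (NCP) at $x^*$, $d^T\nabla^2_{xx}L(x^*,\lambda)d>0$ for all $d\ne0$ with $g_j(x^*)^Td=0$ for each $j$ with $\lambda_j>0$, where $L(x,\lambda)=f_0(x)+\sum_{j\in I}\lambda_jf_j(x)$. Then: (i) $d_0^k$, $d_1^k$, $\tilde d^k$, $q^k$ and $d^k$ all tend to $0$, and $\|x^{k+1}-x^k\|\to0$, as $k\to\infty$; (ii) $x^k\to x^*$; (iii) $\varphi_k\to\varphi(x^*)=0$; moreover $x^*$ is a KKT point of (NCP) with a unique KKT multiplier $\lambda^*$, and $\lambda^k\to\lambda^*$. -/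

import Mathlib

open Filter Topology

noncomputable section

namespace SubfeasibleSQP

/-- `ℝⁿ` with its Euclidean inner product and norm. -/
abbrev E (n : ℕ) : Type := EuclideanSpace ℝ (Fin n)

/-- Minimize `obj x` subject to `con j x ≤ 0` for all `j`. -/
structure Problem (n m : ℕ) where
  obj : E n → ℝ
  con : Fin m → E n → ℝ

namespace Problem

variable {n m : ℕ} (P : Problem n m)

/-- Gradient of the objective. -/
def g₀ (x : E n) : E n := gradient P.obj x

/-- Gradients of the constraint functions. -/
def g (j : Fin m) (x : E n) : E n := gradient (P.con j) x

/-- The constraint violation `φ(x) = max {0, f_j(x) : j ∈ I}`. -/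
def phi (x : E n) : ℝ := Finset.univ.fold max 0 (fun j => P.con j x)

/-- `f̄_j(x)`: equal to `f_j(x)` if `f_j(x) ≤ 0` and to `f_j(x) - φ(x)` otherwise. -/
def conBar (j : Fin m) (x : E n) : ℝ :=
  if P.con j x ≤ 0 then P.con j x else P.con j x - P.phi x

/-- `I(x) = {j : f̄_j(x) = 0}`. -/
def active (x : E n) : Set (Fin m) := {j | P.conBar j x = 0}

/-- The constraint qualification: at every point the gradients indexed by `I(x)` are linearly
independent. -/
def GradientsIndependent : Prop :=
  ∀ x : E n, LinearIndependent ℝ (fun j : P.active x => P.g j x)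

/-- Karush-Kuhn-Tucker pairs. -/
structure IsKKTPair (x : E n) (lam : Fin m → ℝ) : Prop where
  stationary : P.g₀ x + ∑ j, lam j • P.g j x = 0
  feasible : ∀ j, P.con j x ≤ 0
  nonneg : ∀ j, 0 ≤ lam j
  complementary : ∀ j, lam j * P.con j x = 0

/-- `L(x, λ) = f₀(x) + ∑ⱼ λ_j f_j(x)`. -/
def lagrangian (lam : Fin m → ℝ) (x : E n) : ℝ := P.obj x + ∑ j, lam j * P.con j x

/-- The strong second-order sufficient condition at `(x, λ)`: the Hessian in `x` of the Lagrangian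
is positive definite on the orthogonal complement of the gradients with `λ_j > 0`. -/
def SSOSC (x : E n) (lam : Fin m → ℝ) : Prop :=
  ∀ d : E n, d ≠ 0 → (∀ j, 0 < lam j → inner ℝ (P.g j x) d = 0) →
    0 < fderiv ℝ (fderiv ℝ (P.lagrangian lam)) x d d

/-- The feasible set of the quadratic subproblem at `x`. -/
def qpFeasible (x : E n) : Set (E n) :=
  {d | ∀ j, P.conBar j x + inner ℝ (P.g j x) d ≤ 0}

/-- The objective `g₀(x)ᵀd + ½ dᵀBd` of the quadratic subproblem. -/
def qpObj (B : Matrix (Fin n) (Fin n) ℝ) (x d : E n) : ℝ :=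
  inner ℝ (P.g₀ x) d + (1 / 2) * inner ℝ d (B.toEuclideanLin d)

/-- `d₀` is an optimal solution of the quadratic subproblem at `x` with matrix `B`. -/
def IsQPSolution (B : Matrix (Fin n) (Fin n) ℝ) (x d₀ : E n) : Prop :=
  d₀ ∈ P.qpFeasible x ∧ ∀ d ∈ P.qpFeasible x, P.qpObj B x d₀ ≤ P.qpObj B x d

/-- `lam` is a KKT multiplier vector of the quadratic subproblem at its solution `d₀`. -/
structure IsQPMultiplier (B : Matrix (Fin n) (Fin n) ℝ) (x d₀ : E n) (lam : Fin m → ℝ) :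
    Prop where
  stationary : P.g₀ x + B.toEuclideanLin d₀ + ∑ j, lam j • P.g j x = 0
  nonneg : ∀ j, 0 ≤ lam j
  complementary : ∀ j, lam j * (P.conBar j x + inner ℝ (P.g j x) d₀) = 0

/-- `D_j = |f̄_j(x)| (|f̄_j(x) + g_j(x)ᵀd₀| + ‖d₀‖)`. -/
def diagD (x d₀ : E n) (j : Fin m) : ℝ :=
  |P.conBar j x| * (|P.conBar j x + inner ℝ (P.g j x) d₀| + ‖d₀‖)

/-- `(d, h)` solves the linear system with coefficient matrix `[[B, N], [Nᵀ, -diag D]]`, where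
`N = (g_j(x))_j`, and right-hand side `(0, r)`; the two block rows are written out. -/
def SolvesSLE (B : Matrix (Fin n) (Fin n) ℝ) (x d₀ : E n) (r : Fin m → ℝ)
    (d : E n) (h : Fin m → ℝ) : Prop :=
  B.toEuclideanLin d + ∑ j, h j • P.g j x = 0 ∧
    ∀ j, inner ℝ (P.g j x) d - P.diagD x d₀ j * h j = r j

/-- The remainder `F̃_j = f_j(x + d₀) - f_j(x) - g_j(x)ᵀd₀`. -/
def remainder (x d₀ : E n) (j : Fin m) : ℝ :=
  P.con j (x + d₀) - P.con j x - inner ℝ (P.g j x) d₀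

end Problem

/-- The parameters of the algorithm. -/
structure Params where
  (γ η ε θ σ ϱ ξ ζ α ρ δ τ : ℝ)
  γ_pos : 0 < γ
  γ_lt : γ < 1
  η_pos : 0 < η
  η_lt : η < 1
  ε_pos : 0 < ε
  ε_lt : ε < 1
  θ_pos : 0 < θ
  θ_lt : θ < σ
  σ_lt : σ < 1
  ϱ_pos : 0 < ϱ
  ϱ_lt : ϱ < σ
  ξ_pos : 0 < ξ
  ζ_pos : 0 < ζ
  α_pos : 0 < α
  α_lt : α < 1 / 2
  ρ_gt : 1 < ρ
  δ_gt : 2 < δ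
  τ_gt : 2 < τ
  τ_lt : τ < 3

section Tests

variable {n m : ℕ} (P : Problem n m) (p : Params)

/-- The largest `β ∈ [0, 1]` with
`(1 - β) g₀ᵀd₀ + β g₀ᵀd̃ ≤ θ g₀ᵀd₀ + φ(x)^θ`, by its explicit formula. -/
def beta (x d₀ dt : E n) : ℝ :=
  if inner ℝ (P.g₀ x) d₀ < inner ℝ (P.g₀ x) dt then
    min 1 (((p.θ - 1) * inner ℝ (P.g₀ x) d₀ + P.phi x ^ p.θ) /
      (inner ℝ (P.g₀ x) dt - inner ℝ (P.g₀ x) d₀))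
  else 1

/-- The test deciding whether the direction `d = d₀ + d₁` is tried. -/
def DirectionTest (x d₀ d : E n) : Prop :=
  inner ℝ (P.g₀ x) d₀ ≤
    p.ζ * min (-(‖d₀‖ ^ p.δ)) (-(‖d‖ ^ p.δ)) + p.ξ * P.phi x ^ p.ϱ

/-- The acceptance test for the step length `t` along `d = d₀ + d₁`. -/
def StepTestI (x d₀ d : E n) (t : ℝ) : Prop :=
  P.obj (x + t • d) ≤ P.obj x + p.α * t * inner ℝ (P.g₀ x) d₀
      + p.ρ * (1 - p.α) * t * P.phi x ^ p.θ ∧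
  (∀ j, 0 < P.con j x →
    P.con j (x + t • d) ≤ P.phi x - p.α * t * (‖d₀‖ ^ p.τ + P.phi x ^ p.σ)) ∧
  (∀ j, P.con j x ≤ 0 → P.con j (x + t • d) ≤ 0)

/-- The acceptance test for the step length `t` along `q`, with convex-combination weight `β`. -/
def StepTestII (x d₀ q : E n) (β t : ℝ) : Prop :=
  P.obj (x + t • q) ≤ P.obj x + p.γ * t * inner ℝ (P.g₀ x) q
      + p.ρ * (1 - p.γ) * t * P.phi x ^ p.θ ∧
  (∀ j, 0 < P.con j x →
    P.con j (x + t • q) ≤ P.phi x - p.γ * t * β * (‖d₀‖ + P.phi x ^ p.σ)) ∧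
  (∀ j, P.con j x ≤ 0 → P.con j (x + t • q) ≤ 0)

/-- The first cycle succeeds with step length `t`: the direction test holds and `t` is the first
of `1, 1/2, 1/4, …` passing the acceptance test, the search being given up below `ε`. -/
def CycleI (x d₀ d : E n) (t : ℝ) : Prop :=
  DirectionTest P p x d₀ d ∧
    ∃ i : ℕ, t = (1 / 2 : ℝ) ^ i ∧ p.ε ≤ t ∧ StepTestI P p x d₀ d t ∧
      ∀ i' < i, ¬ StepTestI P p x d₀ d ((1 / 2 : ℝ) ^ i')

/-- `t` is the first of `1, η, η², …` passing the acceptance test along `q`. -/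
def CycleII (x d₀ q : E n) (β t : ℝ) : Prop :=
  ∃ i : ℕ, t = p.η ^ i ∧ StepTestII P p x d₀ q β t ∧
    ∀ i' < i, ¬ StepTestII P p x d₀ q β (p.η ^ i')

end Tests

/-- The sequences occurring in an infinite run of the algorithm: iterates `x`, matrices `B`,
subproblem solutions `d₀` with multipliers `lam`, solutions `(d₁, h₁)` and `(dt, ht)` of the two
linear systems, convex combinations `q`, search directions `d` and step lengths `t`. -/
structure Sequences (n m : ℕ) where
  x : ℕ → E n
  B : ℕ → Matrix (Fin n) (Fin n) ℝ
  d₀ : ℕ → E n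
  lam : ℕ → Fin m → ℝ
  d₁ : ℕ → E n
  h₁ : ℕ → Fin m → ℝ
  dt : ℕ → E n
  ht : ℕ → Fin m → ℝ
  q : ℕ → E n
  d : ℕ → E n
  t : ℕ → ℝ

/-- `s` is generated by the algorithm without stopping. The vectors `dt k` and `q k` are used by
the algorithm only in the second cycle, but they are determined by their defining equations at
every iteration. The matrices `B k` are arbitrary symmetric positive definite ones. -/
structure IsGenerated {n m : ℕ} (P : Problem n m) (p : Params) (s : Sequences n m) : Prop where
  posDef : ∀ k, (s.B k).PosDef
  qp_solution : ∀ k, P.IsQPSolution (s.B k) (s.x k) (s.d₀ k)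
  qp_multiplier : ∀ k, P.IsQPMultiplier (s.B k) (s.x k) (s.d₀ k) (s.lam k)
  not_stopped : ∀ k, ¬ (s.d₀ k = 0 ∧ P.phi (s.x k) = 0)
  correction : ∀ k, P.SolvesSLE (s.B k) (s.x k) (s.d₀ k)
    (fun j => -(‖s.d₀ k‖ ^ p.τ + P.phi (s.x k) ^ p.σ) - P.remainder (s.x k) (s.d₀ k) j)
    (s.d₁ k) (s.h₁ k)
  updated : ∀ k, P.SolvesSLE (s.B k) (s.x k) (s.d₀ k)
    (fun _ => -(‖s.d₀ k‖ + P.phi (s.x k) ^ p.σ)) (s.dt k) (s.ht k)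
  combination : ∀ k, s.q k = (1 - beta P p (s.x k) (s.d₀ k) (s.dt k)) • s.d₀ k
    + beta P p (s.x k) (s.d₀ k) (s.dt k) • s.dt k
  search : ∀ k,
    (CycleI P p (s.x k) (s.d₀ k) (s.d₀ k + s.d₁ k) (s.t k) ∧ s.d k = s.d₀ k + s.d₁ k) ∨
    ((∀ t, ¬ CycleI P p (s.x k) (s.d₀ k) (s.d₀ k + s.d₁ k) t) ∧
      CycleII P p (s.x k) (s.d₀ k) (s.q k) (beta P p (s.x k) (s.d₀ k) (s.dt k)) (s.t k) ∧
      s.d k = s.q k)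
  step : ∀ k, s.x (k + 1) = s.x k + s.t k • s.d k

/-- Uniform positive definiteness of a sequence of matrices. -/
def UniformlyPosDef {n : ℕ} (B : ℕ → Matrix (Fin n) (Fin n) ℝ) : Prop :=
  ∃ a b : ℝ, 0 < a ∧ 0 < b ∧ ∀ (k : ℕ) (d : E n),
    a * ‖d‖ ^ 2 ≤ inner ℝ d ((B k).toEuclideanLin d) ∧
      inner ℝ d ((B k).toEuclideanLin d) ≤ b * ‖d‖ ^ 2

end SubfeasibleSQP

end

/-!
Along a bounded run the linear systems are uniformly well posed, because the `B k` are uniformly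
positive definite and the active gradients independent; hence `‖q‖` is at most a multiple of the
residual `S = ‖d₀‖ + φ^σ`. On the other hand the weight `β` of `dt` in `q` cannot be small:
`β S ≥ c (S² + φ^σ)`. So the second-order error `t² ‖q‖²` is dominated by the decrease that the
step test asks for, and the step lengths stay away from zero.

Consequently `φ_{k+1} ≤ max 0 (φ_k - c φ_k^σ)`, and since `σ < 1` the iterates are feasible after
finitely many steps. From then on each step lowers the objective by a multiple of `‖d₀‖²`, so
`d₀ → 0`, all other directions follow, and every cluster point is a KKT point.

A KKT point satisfying the second-order condition is isolated among the KKT points. Otherwise the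
normalized differences `(y - x) / ‖y - x‖` of nearby KKT points `y` would accumulate at a critical
direction `d`. If `μ` is the multiplier at `y`, complementarity bounds the inner product of
`∇L(y, λ) - ∇L(x, λ)` with `y - x` by `∑ j, |μ_j - λ_j| |R_j|`, where `R_j` is the first-order
Taylor remainder of `f_j`; as `μ → λ`, this gives `dᵀ ∇²L(x, λ) d ≤ 0`, a contradiction. Finally, a
bounded sequence whose steps tend to zero converges to any isolated cluster point.
-/

namespace SubfeasibleSQP

section Analysis

variable {ι F : Type*} [NormedAddCommGroup F] [InnerProductSpace ℝ F]

theorem continuous_gradient [CompleteSpace F] {f : F → ℝ} (hf : ContDiff ℝ 1 f) :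
    Continuous (gradient f) :=
  (InnerProductSpace.toDual ℝ F).symm.continuous.comp (hf.continuous_fderiv one_ne_zero)

theorem exists_taylor_bound [CompleteSpace F] {f : F → ℝ} (hf : ContDiff ℝ 2 f) {K : Set F}
    (hK : IsCompact K) (hconv : Convex ℝ K) :
    ∃ M, ∀ x ∈ K, ∀ y ∈ K,
      |f y - f x - inner ℝ (gradient f x) (y - x)| ≤ M * ‖y - x‖ ^ 2 := by
  have hf' : ContDiff ℝ 1 (fderiv ℝ f) := hf.fderiv_right (by norm_num)
  obtain ⟨C, hC⟩ := hK.exists_bound_of_continuousOn (hf'.continuous_fderiv one_ne_zero).continuousOn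
  have hM : ∀ z ∈ K, ‖fderiv ℝ (fderiv ℝ f) z‖ ≤ max C 0 :=
    fun z hz => (hC z hz).trans (le_max_left _ _)
  refine ⟨max C 0, fun x hx y hy => ?_⟩
  have hlip : ∀ z ∈ segment ℝ x y, ‖fderiv ℝ f z - fderiv ℝ f x‖ ≤ max C 0 * ‖y - x‖ := by
    intro z hz
    refine (Convex.norm_image_sub_le_of_norm_fderiv_le (𝕜 := ℝ)
      (fun w _ => hf'.differentiable one_ne_zero w) hM hconv hx
      (hconv.segment_subset hx hy hz)).trans ?_
    gcongr
    exact norm_sub_le_of_mem_segment hz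
  have := Convex.norm_image_sub_le_of_norm_hasFDerivWithin_le' (𝕜 := ℝ) (φ := fderiv ℝ f x)
    (fun z _ => (hf.differentiable two_ne_zero z).hasFDerivAt.hasFDerivWithinAt) hlip
    (convex_segment x y) (left_mem_segment ℝ x y) (right_mem_segment ℝ x y)
  rwa [inner_gradient_left, ← Real.norm_eq_abs, sq, ← mul_assoc]

theorem eventually_forall_taylor_bound [ProperSpace F] {f : F → ℝ} (hf : ContDiff ℝ 2 f)
    {x v : ι → F} (hx : Bornology.IsBounded (Set.range x))
    (hv : Bornology.IsBounded (Set.range v)) :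
    ∀ᶠ M : ℝ in atTop, ∀ i, ∀ t ∈ Set.Icc (0 : ℝ) 1,
      |f (x i + t • v i) - f (x i) - t * inner ℝ (gradient f (x i)) (v i)| ≤
        M * t ^ 2 * ‖v i‖ ^ 2 := by
  obtain ⟨R, hR⟩ := isBounded_iff_forall_norm_le.1 hx
  obtain ⟨S, hS⟩ := isBounded_iff_forall_norm_le.1 hv
  obtain ⟨M₀, hM⟩ := exists_taylor_bound hf (isCompact_closedBall (0 : F) (R + S))
    (convex_closedBall _ _)
  filter_upwards [eventually_ge_atTop M₀] with M hM₀ i t ht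
  have hxi : ‖x i‖ ≤ R := hR _ ⟨i, rfl⟩
  have hvi : ‖v i‖ ≤ S := hS _ ⟨i, rfl⟩
  have htv : ‖t • v i‖ ≤ ‖v i‖ := by
    rw [norm_smul, Real.norm_of_nonneg ht.1]
    exact mul_le_of_le_one_left (norm_nonneg _) ht.2
  have hbound := hM (x i) (by rw [mem_closedBall_zero_iff]; linarith [norm_nonneg (v i)])
    (x i + t • v i) (by
      rw [mem_closedBall_zero_iff]
      linarith [norm_add_le (x i) (t • v i)])
  rw [add_sub_cancel_left, real_inner_smul_right, norm_smul, Real.norm_of_nonneg ht.1, mul_pow,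
    ← mul_assoc] at hbound
  exact hbound.trans (by gcongr)

theorem norm_apply_le_of_form_le {T : F →ₗ[ℝ] F} {b : ℝ} (hT : T.IsSymmetric)
    (hpos : ∀ d, 0 ≤ inner ℝ d (T d)) (hb : ∀ d, inner ℝ d (T d) ≤ b * ‖d‖ ^ 2) (d : F) :
    ‖T d‖ ≤ b * ‖d‖ := by
  have hbd : 0 ≤ b * ‖d‖ := by
    rcases (norm_nonneg d).eq_or_lt with hd | hd
    · simp [← hd]
    · refine nonneg_of_mul_nonneg_left ?_ hd
      linarith [hpos d, hb d]
  rcases (norm_nonneg (T d)).eq_or_lt with hTd | hTd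
  · rwa [← hTd]
  have hcs : inner ℝ d (T (T d)) * inner ℝ (T d) (T d) ≤
      inner ℝ d (T d) * inner ℝ (T d) (T (T d)) :=
    LinearMap.BilinForm.apply_mul_apply_le_of_forall_zero_le ((innerₗ F).compl₂ T) hpos d (T d)
  rw [← hT, real_inner_self_eq_norm_sq] at hcs
  have hbound := hcs.trans
    (mul_le_mul (hb d) (hb (T d)) (hpos _) ((hpos d).trans (hb d)))
  refine le_of_sq_le_sq ?_ hbd
  refine le_of_mul_le_mul_right ?_ (pow_pos hTd 2)
  linarith

theorem mul_norm_le_of_inner_le {g d : F} {a : ℝ} (h : inner ℝ g d ≤ -(a * ‖d‖ ^ 2)) :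
    a * ‖d‖ ≤ ‖g‖ := by
  rcases (norm_nonneg d).eq_or_lt with hd | hd
  · rw [← hd, mul_zero]
    exact norm_nonneg g
  · refine le_of_mul_le_mul_right ?_ hd
    linarith [(abs_le.1 (abs_real_inner_le_norm g d)).1]

theorem eventually_mul_le (X : ℝ) {Y : ℝ} (hY : 0 < Y) : ∀ᶠ t : ℝ in 𝓝[>] 0, t * X ≤ Y := by
  have : Tendsto (fun t : ℝ => t * X) (𝓝[>] 0) (𝓝 0) :=
    (zero_mul X ▸ (continuous_mul_const X).tendsto 0).mono_left nhdsWithin_le_nhds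
  exact this.eventually_le_const hY

theorem eventually_forall_norm_le {ι X G : Type*} [PseudoMetricSpace X] [ProperSpace X]
    [NormedAddCommGroup G] {f : X → G} (hf : Continuous f) {x : ι → X}
    (hx : Bornology.IsBounded (Set.range x)) : ∀ᶠ V : ℝ in atTop, ∀ i, ‖f (x i)‖ ≤ V := by
  obtain ⟨C, hC⟩ := hx.isCompact_closure.exists_bound_of_continuousOn hf.continuousOn
  filter_upwards [eventually_ge_atTop C] with V hV i
  exact (hC _ (subset_closure ⟨i, rfl⟩)).trans hV

end Analysis

section NormalizedDirections

variable {V W : Type*} [NormedAddCommGroup V] [NormedSpace ℝ V] [NormedAddCommGroup W]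
  [NormedSpace ℝ W]

theorem exists_tendsto_normalized_sub_of_frequently [FiniteDimensional ℝ V] {x : V} {p : V → Prop}
    (hp : ∃ᶠ y in 𝓝[≠] x, p y) :
    ∃ U : Ultrafilter V, ↑U ≤ 𝓝[≠] x ∧ (∀ᶠ y in U, p y) ∧
      ∃ d ≠ 0, Tendsto (fun y => ‖y - x‖⁻¹ • (y - x)) U (𝓝 d) := by
  have : NeBot (𝓝[≠] x ⊓ 𝓟 {y | p y}) := frequently_mem_iff_neBot.1 hp
  obtain ⟨U, hU⟩ := Ultrafilter.exists_le (𝓝[≠] x ⊓ 𝓟 {y | p y})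
  have hne : (U : Filter V) ≤ 𝓝[≠] x := hU.trans inf_le_left
  have hsphere : ∀ᶠ y in U, ‖y - x‖⁻¹ • (y - x) ∈ Metric.sphere (0 : V) 1 := by
    filter_upwards [hne self_mem_nhdsWithin] with y hy
    rw [mem_sphere_zero_iff_norm, norm_smul, norm_inv, norm_norm,
      inv_mul_cancel₀ (norm_ne_zero_iff.2 (sub_ne_zero.2 hy))]
  have := FiniteDimensional.proper_real V
  obtain ⟨d, hd, hUd⟩ := (isCompact_sphere (0 : V) 1).ultrafilter_le_nhds
    (U.map fun y => ‖y - x‖⁻¹ • (y - x)) (le_principal_iff.2 hsphere)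
  exact ⟨U, hne, le_principal_iff.1 (hU.trans inf_le_right), d,
    ne_zero_of_mem_unit_sphere ⟨d, hd⟩, hUd⟩

theorem tendsto_normalized_sub_of_hasFDerivAt {f : V → W} {f' : V →L[ℝ] W} {x d : V}
    {l : Filter V} (hf : HasFDerivAt f f' x) (hl : l ≤ 𝓝 x)
    (hd : Tendsto (fun y => ‖y - x‖⁻¹ • (y - x)) l (𝓝 d)) :
    Tendsto (fun y => ‖y - x‖⁻¹ • (f y - f x)) l (𝓝 (f' d)) := by
  have hsub : Tendsto (fun y => y - x) l (𝓝 0) := tendsto_sub_nhds_zero_iff.2 hl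
  simpa using (hasFDerivWithinAt_univ.2 hf).lim hsub (by simp) hd

theorem tendsto_inv_sq_mul_apply_sub {F : V → V →L[ℝ] ℝ} {F' : V →L[ℝ] V →L[ℝ] ℝ} {x d : V}
    {l : Filter V} (hF : HasFDerivAt F F' x) (hx : F x = 0) (hl : l ≤ 𝓝 x)
    (hd : Tendsto (fun y => ‖y - x‖⁻¹ • (y - x)) l (𝓝 d)) :
    Tendsto (fun y => (‖y - x‖ ^ 2)⁻¹ * F y (y - x)) l (𝓝 (F' d d)) := by
  have hlim := ((continuous_fst.clm_apply continuous_snd).tendsto (F' d, d)).comp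
    ((tendsto_normalized_sub_of_hasFDerivAt hF hl hd).prodMk_nhds hd)
  refine hlim.congr fun y => ?_
  simp only [Function.comp_apply, hx, sub_zero, smul_apply, map_smul, smul_eq_mul]
  ring

end NormalizedDirections

section RealSequences

theorem tendsto_of_isolated_mapClusterPt {X : Type*} [PseudoMetricSpace X] [ProperSpace X]
    {x : ℕ → X} {xs : X} (hstep : Tendsto (fun k => dist (x (k + 1)) (x k)) atTop (𝓝 0))
    (hxs : MapClusterPt xs atTop x) (hiso : ∀ᶠ y in 𝓝[≠] xs, ¬ MapClusterPt y atTop x) :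
    Tendsto x atTop (𝓝 xs) := by
  obtain ⟨r, hr, hiso⟩ := Metric.nhds_basis_closedBall.eventually_iff.1
    (eventually_nhdsWithin_iff.1 hiso)
  refine Metric.tendsto_atTop.2 fun e he => ?_
  obtain ⟨e', he', hle⟩ : ∃ e' > 0, e' ≤ r ∧ e' ≤ e := ⟨min r e, lt_min hr he, by simp⟩
  have havoid : ∀ᶠ k in atTop, x k ∉ Metric.closedBall xs e' \ Metric.ball xs (e' / 2) := by
    refine not_frequently.1 fun hfreq => ?_
    obtain ⟨y, hy, hcl⟩ := ((isCompact_closedBall xs e').diff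
      Metric.isOpen_ball).exists_mapClusterPt_of_frequently hfreq
    refine hiso (Metric.closedBall_subset_closedBall hle.1 hy.1) ?_ hcl
    rintro rfl
    exact hy.2 (Metric.mem_ball_self (half_pos he'))
  have hsmall : ∀ᶠ k in atTop, dist (x (k + 1)) (x k) < e' / 2 :=
    hstep.eventually_lt_const (half_pos he')
  obtain ⟨N, hN⟩ := eventually_atTop.1 (havoid.and hsmall)
  obtain ⟨k₀, hk₀, hin⟩ := frequently_atTop.1
    (hxs.frequently (Metric.ball_mem_nhds xs (half_pos he'))) N
  have hstay : ∀ k ≥ k₀, dist (x k) xs < e' / 2 := by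
    intro k hk
    induction k, hk using Nat.le_induction with
    | base => exact hin
    | succ k hk ih =>
      have hclosed : dist (x (k + 1)) xs ≤ e' := by
        linarith [dist_triangle (x (k + 1)) (x k) xs, (hN k (hk₀.trans hk)).2]
      by_contra hout
      exact (hN (k + 1) (by omega)).1 ⟨hclosed, hout⟩
  exact ⟨k₀, fun k hk => (hstay k hk).trans (by linarith [hle.2])⟩

theorem eventually_eq_zero_of_le_max_sub {u : ℕ → ℝ} {c σ : ℝ} (hc : 0 < c) (hσ : 0 ≤ σ)
    (hσ' : σ < 1) (hu : ∀ k, 0 ≤ u k) (hstep : ∀ k, u (k + 1) ≤ max 0 (u k - c * u k ^ σ)) :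
    ∀ᶠ k in atTop, u k = 0 := by
  have hanti : Antitone u := antitone_nat_of_succ_le fun k =>
    (hstep k).trans (max_le (hu k) (sub_le_self _ (by have := hu k; positivity)))
  have hlim := tendsto_atTop_ciInf hanti ⟨0, Set.forall_mem_range.2 hu⟩
  set L := ⨅ k, u k
  have hL : L = 0 := by
    have hrec : L ≤ max 0 (L - c * L ^ σ) := le_of_tendsto_of_tendsto'
      (hlim.comp (tendsto_add_atTop_nat 1))
      (tendsto_const_nhds.max (hlim.sub ((hlim.rpow_const (.inr hσ)).const_mul c))) hstep
    refine ((Real.iInf_nonneg hu).eq_or_lt).elim Eq.symm fun hpos => ?_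
    have : 0 < c * L ^ σ := by positivity
    rcases le_max_iff.1 hrec with h | h <;> linarith
  have hpow : Tendsto (fun k => u k ^ (1 - σ)) atTop (𝓝 0) := by
    have h := hlim.rpow_const (p := 1 - σ) (.inr (by linarith))
    rwa [hL, Real.zero_rpow (by linarith)] at h
  rw [← map_add_atTop_eq_nat 1, eventually_map]
  filter_upwards [hpow.eventually_le_const hc] with k hk
  refine le_antisymm ((hstep k).trans (max_le le_rfl (sub_nonpos.2 ?_))) (hu _)
  calc u k = u k ^ (1 - σ) * u k ^ σ := by
        rw [← Real.rpow_add_of_nonneg (hu k) (by linarith) hσ, sub_add_cancel, Real.rpow_one]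
    _ ≤ c * u k ^ σ := by gcongr; exact Real.rpow_nonneg (hu k) σ

theorem tendsto_zero_of_succ_le_sub {f u : ℕ → ℝ} (hf : BddBelow (Set.range f))
    (hu : ∀ k, 0 ≤ u k) (hstep : ∀ᶠ k in atTop, f (k + 1) ≤ f k - u k) :
    Tendsto u atTop (𝓝 0) := by
  obtain ⟨K, hK⟩ := eventually_atTop.1 hstep
  have hstep' : ∀ i, f (i + 1 + K) ≤ f (i + K) - u (i + K) := fun i => by
    rw [add_right_comm]
    exact hK (i + K) (Nat.le_add_left K i)
  have hlim := tendsto_atTop_ciInf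
    (antitone_nat_of_succ_le fun i => (hstep' i).trans (sub_le_self _ (hu _)))
    (hf.mono (Set.range_comp_subset_range (fun i => i + K) f))
  rw [← tendsto_add_atTop_iff_nat K]
  refine squeeze_zero (fun i => hu _) (fun i => le_sub_comm.1 (hstep' i)) ?_
  simpa using hlim.sub (hlim.comp (tendsto_add_atTop_nat 1))

theorem rpow_le_mul_rpow {u V θ σ : ℝ} (hu : 0 ≤ u) (huV : u ≤ V) (hV : 1 ≤ V) (hθ : 0 ≤ θ)
    (hθσ : θ ≤ σ) (hσ : σ ≤ θ + 1) : u ^ σ ≤ V * u ^ θ := by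
  have hle : u ^ (σ - θ) ≤ V :=
    calc u ^ (σ - θ) ≤ V ^ (σ - θ) := by gcongr
      _ ≤ V ^ (1 : ℝ) := by gcongr; linarith
      _ = V := Real.rpow_one V
  calc u ^ σ = u ^ (σ - θ) * u ^ θ := by
        rw [← Real.rpow_add_of_nonneg hu (sub_nonneg.2 hθσ) hθ, sub_add_cancel]
    _ ≤ V * u ^ θ := by gcongr

end RealSequences

section LinearIndependence

variable {ι α F : Type*} [Fintype ι] [NormedAddCommGroup F]

theorem norm_sum_smul_le [NormedSpace ℝ F] (h : ι → ℝ) (v : ι → F) :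
    ‖∑ i, h i • v i‖ ≤ ‖h‖ * ∑ i, ‖v i‖ := by
  rw [Finset.mul_sum]
  refine norm_sum_le_of_le _ fun i _ => ?_
  rw [norm_smul]
  gcongr
  exact norm_le_pi_norm h i

theorem exists_eventually_norm_le_mul_norm_sum_smul [NormedSpace ℝ F] {l : Filter α}
    {v : α → ι → F} {w : ι → F} (hw : LinearIndependent ℝ w)
    (hv : ∀ i, Tendsto (fun x => v x i) l (𝓝 (w i))) :
    ∃ C > 0, ∀ᶠ x in l, ∀ h : ι → ℝ, ‖h‖ ≤ C * ‖∑ i, h i • v x i‖ := by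
  obtain ⟨K, hK, hanti⟩ := (Fintype.linearCombination ℝ w).exists_antilipschitzWith
    (LinearMap.ker_eq_bot'.2 fun h hh => funext (Fintype.linearIndependent_iff.1 hw h hh))
  have hsum : Tendsto (fun x => K * ∑ i, ‖w i - v x i‖) l (𝓝 0) := by
    simpa using (tendsto_finsetSum Finset.univ fun i _ =>
      ((hv i).const_sub (w i)).norm).const_mul (K : ℝ)
  refine ⟨2 * K, mul_pos two_pos (NNReal.coe_pos.2 hK), ?_⟩
  filter_upwards [hsum.eventually_le_const one_half_pos] with x hx h
  have hbase : ‖h‖ ≤ K * ‖∑ i, h i • w i‖ := by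
    simpa [Fintype.linearCombination_apply] using hanti.le_mul_dist h 0
  have hsplit : ∑ i, h i • w i = ∑ i, h i • v x i + ∑ i, h i • (w i - v x i) := by
    rw [← Finset.sum_add_distrib]
    exact Finset.sum_congr rfl fun i _ => by rw [← smul_add, add_sub_cancel]
  have hpert : K * ‖∑ i, h i • (w i - v x i)‖ ≤ ‖h‖ / 2 :=
    calc K * ‖∑ i, h i • (w i - v x i)‖ ≤ K * (‖h‖ * ∑ i, ‖w i - v x i‖) := by
          gcongr; exact norm_sum_smul_le h _
      _ = ‖h‖ * (K * ∑ i, ‖w i - v x i‖) := by ring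
      _ ≤ ‖h‖ * (1 / 2) := by gcongr
      _ = ‖h‖ / 2 := by ring
  have htri : K * ‖∑ i, h i • w i‖ ≤
      K * (‖∑ i, h i • v x i‖ + ‖∑ i, h i • (w i - v x i)‖) := by
    rw [hsplit]
    gcongr
    exact norm_add_le _ _
  linarith

theorem exists_eventually_norm_le_mul_norm_sum_smul_of_support [NormedSpace ℝ F] {l : Filter α}
    {v : α → ι → F} {w : ι → F} {A : Set ι} (hw : LinearIndependent ℝ fun i : A => w i)
    (hv : ∀ i, Tendsto (fun x => v x i) l (𝓝 (w i))) :
    ∃ C > 0, ∀ᶠ x in l, ∀ h : ι → ℝ, (∀ i ∉ A, h i = 0) →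
      ‖h‖ ≤ C * ‖∑ i, h i • v x i‖ := by
  classical
  obtain ⟨C, hC, hev⟩ := exists_eventually_norm_le_mul_norm_sum_smul hw fun i => hv i
  refine ⟨C, hC, hev.mono fun x hx h hh => ?_⟩
  have hsum : ∑ i : A, h i • v x i = ∑ i, h i • v x i := by
    rw [Finset.sum_set_coe (f := fun i => h i • v x i)]
    refine Finset.sum_subset (Finset.subset_univ _) fun i _ hi => ?_
    rw [hh i (by simpa using hi), zero_smul]
  have hres := hx fun i => h i
  rw [hsum] at hres
  refine le_trans ((pi_norm_le_iff_of_nonneg (norm_nonneg _)).2 fun i => ?_) hres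
  by_cases hi : i ∈ A
  · exact norm_le_pi_norm (fun i : A => h i) ⟨i, hi⟩
  · rw [hh i hi, norm_zero]
    exact norm_nonneg _

theorem inner_add_sum_mul_sq_eq [InnerProductSpace ℝ F] {v : ι → F} {d w : F} {D h r : ι → ℝ}
    (hw : w + ∑ i, h i • v i = 0) (hr : ∀ i, inner ℝ (v i) d - D i * h i = r i) :
    inner ℝ d w + ∑ i, D i * h i ^ 2 = -∑ i, h i * r i := by
  rw [eq_neg_of_add_eq_zero_left hw, inner_neg_right, inner_sum, neg_add_eq_sub,
    ← Finset.sum_sub_distrib, ← Finset.sum_neg_distrib]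
  refine Finset.sum_congr rfl fun i _ => ?_
  rw [real_inner_smul_right, real_inner_comm, ← hr i]
  ring

theorem norm_le_of_add_sum_smul_eq_zero [NormedSpace ℝ F] {v : ι → F} {w : F} {h : ι → ℝ}
    {A : Set ι} {s W C : ℝ} (hC : 0 ≤ C) (hs : 0 ≤ s) (hw : w + ∑ i, h i • v i = 0)
    (hwW : ‖w‖ ≤ W) (hh : ∀ i ∉ A, |h i| ≤ s)
    (hA : ∀ g : ι → ℝ, (∀ i ∉ A, g i = 0) → ‖g‖ ≤ C * ‖∑ i, g i • v i‖) :
    ‖h‖ ≤ C * (W + s * ∑ i, ‖v i‖) + s := by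
  have hcompl : ‖Aᶜ.indicator h‖ ≤ s := (pi_norm_le_iff_of_nonneg hs).2 fun i => by
    by_cases hi : i ∈ A
    · simpa [hi] using hs
    · simpa [hi] using hh i hi
  have hsplit : ∑ i, A.indicator h i • v i = -(w + ∑ i, Aᶜ.indicator h i • v i) := by
    rw [eq_neg_iff_add_eq_zero, add_left_comm, ← Finset.sum_add_distrib]
    convert hw using 4 with i
    rw [← add_smul]
    exact congrArg (· • v i) (congrFun (Set.indicator_self_add_compl A h) i)
  have hind : ‖A.indicator h‖ ≤ C * (W + s * ∑ i, ‖v i‖) := by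
    refine (hA _ fun i hi => Set.indicator_of_notMem hi h).trans ?_
    rw [hsplit, norm_neg]
    gcongr
    exact (norm_add_le _ _).trans (add_le_add hwW ((norm_sum_smul_le _ v).trans (by gcongr)))
  rw [← Set.indicator_self_add_compl A h]
  exact (norm_add_le _ _).trans (add_le_add hind hcompl)

/- The energy identity, obtained by testing the first equation with `d`, controls `d` and the `h i`
with `i ∉ A`; the other `h i` are then read off the first equation by linear independence. -/
theorem norm_le_of_saddlePoint [InnerProductSpace ℝ F] {v : ι → F} {d w : F} {D h r : ι → ℝ}
    {A : Set ι} {b e C G : ℝ} (he : 0 < e) (hb : 0 ≤ b) (hC : 0 ≤ C) (hG : 0 ≤ G)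
    (hw : w + ∑ i, h i • v i = 0) (hr : ∀ i, inner ℝ (v i) d - D i * h i = r i)
    (hcoer : e * ‖d‖ ^ 2 ≤ inner ℝ d w) (hwd : ‖w‖ ≤ b * ‖d‖) (hD : ∀ i, 0 ≤ D i)
    (hDA : ∀ i ∉ A, e ≤ D i) (hv : ∑ i, ‖v i‖ ≤ G)
    (hA : ∀ g : ι → ℝ, (∀ i ∉ A, g i = 0) → ‖g‖ ≤ C * ‖∑ i, g i • v i‖) :
    ‖d‖ ≤ (1 + C * (b + G)) ^ 2 * Fintype.card ι / e * ‖r‖ ∧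
      ‖h‖ ≤ (1 + C * (b + G)) ^ 2 * Fintype.card ι / e * ‖r‖ := by
  set L := 1 + C * (b + G)
  have hL : 1 ≤ L := le_add_of_nonneg_right (by positivity)
  have hDh : ∀ i, 0 ≤ D i * h i ^ 2 := fun i => mul_nonneg (hD i) (sq_nonneg _)
  have henergy : inner ℝ d w + ∑ i, D i * h i ^ 2 ≤ Fintype.card ι * (‖h‖ * ‖r‖) := by
    rw [inner_add_sum_mul_sq_eq hw hr, ← Finset.sum_neg_distrib, ← nsmul_eq_mul]
    refine Finset.sum_le_card_nsmul _ _ _ fun i _ => (neg_le_abs _).trans ?_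
    rw [abs_mul]
    exact mul_le_mul (norm_le_pi_norm h i) (norm_le_pi_norm r i) (abs_nonneg _) (norm_nonneg _)
  set s := √(Fintype.card ι * (‖h‖ * ‖r‖) / e)
  have hs : 0 ≤ s := Real.sqrt_nonneg _
  have hd : ‖d‖ ≤ s := by
    refine Real.le_sqrt_of_sq_le ((le_div_iff₀' he).2 ?_)
    linarith [Finset.sum_nonneg fun i (_ : i ∈ Finset.univ) => hDh i]
  have hh : ∀ i ∉ A, |h i| ≤ s := by
    intro i hi
    refine Real.le_sqrt_of_sq_le ((le_div_iff₀' he).2 ?_)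
    have hterm := Finset.single_le_sum (fun i _ => hDh i) (Finset.mem_univ i)
    have hcoef := mul_le_mul_of_nonneg_right (hDA i hi) (sq_nonneg (h i))
    rw [sq_abs]
    linarith [(mul_nonneg he.le (sq_nonneg ‖d‖)).trans hcoer]
  have hhL : ‖h‖ ≤ L * s :=
    calc ‖h‖ ≤ C * (b * s + s * ∑ i, ‖v i‖) + s :=
          norm_le_of_add_sum_smul_eq_zero hC hs hw (hwd.trans (by gcongr)) hh hA
      _ ≤ C * (b * s + s * G) + s := by gcongr
      _ = L * s := by ring
  have hsr : s ≤ L * Fintype.card ι / e * ‖r‖ := by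
    refine hs.eq_or_lt.elim (fun h0 => h0 ▸ by positivity) fun hpos => ?_
    refine le_of_mul_le_mul_right ?_ hpos
    calc s * s = Fintype.card ι * (‖h‖ * ‖r‖) / e := Real.mul_self_sqrt (by positivity)
      _ ≤ Fintype.card ι * (L * s * ‖r‖) / e := by gcongr
      _ = L * Fintype.card ι / e * ‖r‖ * s := by ring
  have hLs : L * s ≤ L ^ 2 * Fintype.card ι / e * ‖r‖ :=
    calc L * s ≤ L * (L * Fintype.card ι / e * ‖r‖) := by gcongr
      _ = L ^ 2 * Fintype.card ι / e * ‖r‖ := by ring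
  exact ⟨hd.trans ((le_mul_of_one_le_left hs hL).trans hLs), hhL.trans hLs⟩

end LinearIndependence

namespace Problem

section Basic

variable {n m : ℕ} (P : Problem n m)

theorem continuous_g₀ (hobj : ContDiff ℝ 1 P.obj) : Continuous P.g₀ := continuous_gradient hobj

theorem continuous_g {j : Fin m} (hcon : ContDiff ℝ 1 (P.con j)) : Continuous (P.g j) :=
  continuous_gradient hcon

theorem phi_le_iff {x : E n} {c : ℝ} : P.phi x ≤ c ↔ 0 ≤ c ∧ ∀ j, P.con j x ≤ c := by
  simp [phi, Finset.fold_max_le]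

theorem phi_nonneg (x : E n) : 0 ≤ P.phi x := (P.phi_le_iff.1 le_rfl).1

theorem con_le_phi (j : Fin m) (x : E n) : P.con j x ≤ P.phi x := (P.phi_le_iff.1 le_rfl).2 j

theorem phi_eq_zero_iff {x : E n} : P.phi x = 0 ↔ ∀ j, P.con j x ≤ 0 := by
  rw [← (P.phi_nonneg x).ge_iff_eq', phi_le_iff]
  simp

theorem continuous_phi (hcon : ∀ j, Continuous (P.con j)) : Continuous P.phi := by
  classical
  unfold phi
  induction (Finset.univ : Finset (Fin m)) using Finset.induction_on with
  | empty => simpa using continuous_const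
  | insert j s hj ih =>
    simp only [Finset.fold_insert hj]
    exact (hcon j).max ih

theorem conBar_nonpos (j : Fin m) (x : E n) : P.conBar j x ≤ 0 := by
  unfold conBar
  split_ifs with h
  · exact h
  · exact sub_nonpos.2 (P.con_le_phi j x)

theorem conBar_le_con (j : Fin m) (x : E n) : P.conBar j x ≤ P.con j x := by
  unfold conBar
  split_ifs
  · exact le_rfl
  · exact sub_le_self _ (P.phi_nonneg x)

theorem conBar_eq_con {x : E n} {j : Fin m} (h : P.con j x ≤ 0) : P.conBar j x = P.con j x :=
  if_pos h

theorem conBar_eq_sub_phi {x : E n} {j : Fin m} (h : 0 < P.con j x) :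
    P.conBar j x = P.con j x - P.phi x :=
  if_neg h.not_ge

theorem abs_conBar_le (j : Fin m) (x : E n) : |P.conBar j x| ≤ |P.con j x| + P.phi x := by
  rw [abs_of_nonpos (P.conBar_nonpos j x)]
  rcases le_or_gt (P.con j x) 0 with h | h
  · rw [P.conBar_eq_con h]
    linarith [neg_le_abs (P.con j x), P.phi_nonneg x]
  · rw [P.conBar_eq_sub_phi h]
    linarith [abs_nonneg (P.con j x)]

theorem upperSemicontinuous_conBar (hcon : ∀ j, Continuous (P.con j)) (j : Fin m) :
    UpperSemicontinuous (P.conBar j) := by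
  intro x c hc
  rcases le_or_gt (P.con j x) 0 with h | h
  · rw [P.conBar_eq_con h] at hc
    exact ((hcon j).continuousAt.eventually_lt_const hc).mono fun y hy =>
      (P.conBar_le_con j y).trans_lt hy
  · rw [P.conBar_eq_sub_phi h] at hc
    filter_upwards [(hcon j).continuousAt.eventually_const_lt h,
      ((hcon j).sub (P.continuous_phi hcon)).continuousAt.eventually_lt_const hc] with y hy hyc
    rwa [P.conBar_eq_sub_phi hy]

theorem diagD_nonneg (x d₀ : E n) (j : Fin m) : 0 ≤ P.diagD x d₀ j := by
  unfold diagD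
  positivity

theorem sq_conBar_le_diagD (x d₀ : E n) (j : Fin m) :
    P.conBar j x ^ 2 ≤ P.diagD x d₀ j * (1 + ‖P.g j x‖) := by
  have hinner := abs_real_inner_le_norm (P.g j x) d₀
  have habs : |P.conBar j x| ≤
      (|P.conBar j x + inner ℝ (P.g j x) d₀| + ‖d₀‖) * (1 + ‖P.g j x‖) := by
    have htri := abs_sub (P.conBar j x + inner ℝ (P.g j x) d₀) (inner ℝ (P.g j x) d₀)
    rw [add_sub_cancel_right] at htri
    linarith [norm_nonneg d₀, mul_nonneg (abs_nonneg (P.conBar j x + inner ℝ (P.g j x) d₀))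
      (norm_nonneg (P.g j x))]
  rw [← sq_abs, sq, diagD, mul_assoc]
  gcongr

theorem eventually_le_diagD (hcon : ∀ j, ContDiff ℝ 1 (P.con j)) {x₀ : E n} {j : Fin m}
    (hj : j ∉ P.active x₀) :
    ∀ᶠ e in 𝓝[>] (0 : ℝ), ∀ᶠ x in 𝓝 x₀, ∀ d₀, e ≤ P.diagD x d₀ j := by
  obtain ⟨κ, hκx, hκ⟩ := exists_between (lt_of_le_of_ne (P.conBar_nonpos j x₀) hj)
  filter_upwards [eventually_mul_le (1 + (‖P.g j x₀‖ + 1)) (sq_pos_of_neg hκ)] with e he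
  filter_upwards [P.upperSemicontinuous_conBar (fun j => (hcon j).continuous) j x₀ κ hκx,
    (P.continuous_g (hcon j)).norm.continuousAt.eventually_lt_const (lt_add_one _)]
    with x hx hg d₀
  refine le_of_mul_le_mul_right (he.trans ?_) (show 0 < 1 + (‖P.g j x₀‖ + 1) by positivity)
  calc κ ^ 2 ≤ P.conBar j x ^ 2 := by nlinarith
    _ ≤ P.diagD x d₀ j * (1 + ‖P.g j x‖) := P.sq_conBar_le_diagD x d₀ j
    _ ≤ P.diagD x d₀ j * (1 + (‖P.g j x₀‖ + 1)) := by
      gcongr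
      exact P.diagD_nonneg x d₀ j

end Basic

section LinearSystem

variable {n m : ℕ} (P : Problem n m)

/-- `C` bounds the solution of every linear system at `x` in terms of its right-hand side, as long
as the matrix has coercivity constant `a` and norm at most `b` along the solution. -/
def IsSLEBound (a b C : ℝ) (x : E n) : Prop :=
  ∀ ⦃B : Matrix (Fin n) (Fin n) ℝ⦄ ⦃d₀ : E n⦄ ⦃r : Fin m → ℝ⦄ ⦃d : E n⦄ ⦃h : Fin m → ℝ⦄,
    a * ‖d‖ ^ 2 ≤ inner ℝ d (B.toEuclideanLin d) → ‖B.toEuclideanLin d‖ ≤ b * ‖d‖ →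
      P.SolvesSLE B x d₀ r d h → ‖d‖ ≤ C * ‖r‖ ∧ ‖h‖ ≤ C * ‖r‖

theorem eventually_isSLEBound_nhds (hcon : ∀ j, ContDiff ℝ 1 (P.con j)) {a b : ℝ} (ha : 0 < a)
    (hb : 0 ≤ b) {x₀ : E n} (hind : LinearIndependent ℝ fun j : P.active x₀ => P.g j x₀) :
    ∀ᶠ z : ℝ × E n in atTop ×ˢ 𝓝 x₀, P.IsSLEBound a b z.1 z.2 := by
  have hg : ∀ j, Continuous (P.g j) := fun j => P.continuous_g (hcon j)
  obtain ⟨C, hC, hA⟩ := exists_eventually_norm_le_mul_norm_sum_smul_of_support (l := 𝓝 x₀)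
    (v := fun x j => P.g j x) (w := fun j => P.g j x₀) hind fun j => (hg j).tendsto x₀
  obtain ⟨e, he, hea, heD⟩ : ∃ e > 0, e ≤ a ∧
      ∀ᶠ x in 𝓝 x₀, ∀ j ∉ P.active x₀, ∀ d₀, e ≤ P.diagD x d₀ j := by
    have hD : ∀ᶠ e in 𝓝[>] (0 : ℝ), ∀ j, j ∉ P.active x₀ →
        ∀ᶠ x in 𝓝 x₀, ∀ d₀, e ≤ P.diagD x d₀ j :=
      eventually_all.2 fun j => eventually_imp_distrib_left.2 (P.eventually_le_diagD hcon)
    obtain ⟨e, hpos, hle, heD⟩ :=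
      (eventually_mem_nhdsWithin.and ((eventually_mul_le 1 ha).and hD)).exists
    exact ⟨e, hpos, by rwa [mul_one] at hle,
      eventually_all.2 fun j => eventually_imp_distrib_left.2 (heD j)⟩
  obtain ⟨G, hG⟩ := exists_gt (∑ j, ‖P.g j x₀‖)
  have hG₀ : 0 ≤ G := (Finset.sum_nonneg fun j _ => norm_nonneg (P.g j x₀)).trans hG.le
  have hgG : ∀ᶠ x in 𝓝 x₀, ∑ j, ‖P.g j x‖ < G :=
    (continuous_finsetSum _ fun j _ => (hg j).norm).continuousAt.eventually_lt_const hG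
  filter_upwards [prod_mem_prod (Ici_mem_atTop ((1 + C * (b + G)) ^ 2 * Fintype.card (Fin m) / e))
    (hA.and (heD.and hgG))] with ⟨C', x⟩ ⟨hC', hAx, hDx, hGx⟩ B d₀ r d h hcoer hbd hS
  have hbound := norm_le_of_saddlePoint he hb hC.le hG₀ hS.1 hS.2
    ((mul_le_mul_of_nonneg_right hea (sq_nonneg _)).trans hcoer) hbd (P.diagD_nonneg x d₀)
    (fun j hj => hDx j hj d₀) hGx.le hAx
  have hle := mul_le_mul_of_nonneg_right (Set.mem_Ici.1 hC') (norm_nonneg r)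
  exact ⟨hbound.1.trans hle, hbound.2.trans hle⟩

theorem eventually_forall_isSLEBound (hcon : ∀ j, ContDiff ℝ 1 (P.con j))
    (hind : P.GradientsIndependent) {a b : ℝ} (ha : 0 < a) (hb : 0 ≤ b) {K : Set (E n)}
    (hK : IsCompact K) : ∀ᶠ C in atTop, ∀ x ∈ K, P.IsSLEBound a b C x := by
  have hprod := hK.mem_prod_nhdsSet_of_forall fun x _ =>
    P.eventually_isSLEBound_nhds hcon ha hb (hind x)
  filter_upwards [Eventually.curry hprod] with C hC x hx
  exact hC.self_of_nhdsSet x hx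

end LinearSystem

section KKT

variable {n m : ℕ} {α : Type*} {l : Filter α}

/-- The pairs `(y i, mu i)` converge to stationarity at `x` along `l`. The complementarity
condition is that of a subproblem in which the constraints are linearized along a vanishing
direction `d i`; exact KKT pairs are the case `d = 0`. -/
structure AsymptoticKKT (P : Problem n m) (l : Filter α) (y d : α → E n) (mu : α → Fin m → ℝ)
    (x : E n) : Prop where
  tendsto_point : Tendsto y l (𝓝 x)
  tendsto_direction : Tendsto d l (𝓝 0)
  tendsto_stationary :
    Tendsto (fun i => P.g₀ (y i) + ∑ j, mu i j • P.g j (y i)) l (𝓝 0)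
  feasible : ∀ᶠ i in l, ∀ j, P.con j (y i) ≤ 0
  nonneg : ∀ᶠ i in l, ∀ j, 0 ≤ mu i j
  complementary : ∀ᶠ i in l, ∀ j, mu i j * (P.con j (y i) + inner ℝ (P.g j (y i)) (d i)) = 0

variable {P : Problem n m} {y d : α → E n} {mu : α → Fin m → ℝ} {x : E n} {lam : Fin m → ℝ}

theorem asymptoticKKT_of_isKKTPair (hy : Tendsto y l (𝓝 x))
    (h : ∀ᶠ i in l, P.IsKKTPair (y i) (mu i)) : P.AsymptoticKKT l y 0 mu x where
  tendsto_point := hy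
  tendsto_direction := tendsto_const_nhds
  tendsto_stationary := tendsto_const_nhds.congr' (h.mono fun _ hi => hi.stationary.symm)
  feasible := h.mono fun _ hi => hi.feasible
  nonneg := h.mono fun _ hi => hi.nonneg
  complementary := h.mono fun _ hi j => by simpa using hi.complementary j

namespace AsymptoticKKT

theorem mono (h : P.AsymptoticKKT l y d mu x) {l' : Filter α} (hl : l' ≤ l) :
    P.AsymptoticKKT l' y d mu x where
  tendsto_point := h.tendsto_point.mono_left hl
  tendsto_direction := h.tendsto_direction.mono_left hl
  tendsto_stationary := h.tendsto_stationary.mono_left hl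
  feasible := h.feasible.filter_mono hl
  nonneg := h.nonneg.filter_mono hl
  complementary := h.complementary.filter_mono hl

theorem con_nonpos [l.NeBot] (hcon : ∀ j, ContDiff ℝ 1 (P.con j))
    (h : P.AsymptoticKKT l y d mu x) (j : Fin m) : P.con j x ≤ 0 :=
  le_of_tendsto (((hcon j).continuous.tendsto x).comp h.tendsto_point)
    (h.feasible.mono fun _ hi => hi j)

theorem tendsto_g₀ (hobj : ContDiff ℝ 1 P.obj) (h : P.AsymptoticKKT l y d mu x) :
    Tendsto (fun i => P.g₀ (y i)) l (𝓝 (P.g₀ x)) :=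
  ((P.continuous_g₀ hobj).tendsto x).comp h.tendsto_point

theorem tendsto_g (hcon : ∀ j, ContDiff ℝ 1 (P.con j)) (h : P.AsymptoticKKT l y d mu x)
    (j : Fin m) : Tendsto (fun i => P.g j (y i)) l (𝓝 (P.g j x)) :=
  ((P.continuous_g (hcon j)).tendsto x).comp h.tendsto_point

theorem tendsto_linearization (hcon : ∀ j, ContDiff ℝ 1 (P.con j))
    (h : P.AsymptoticKKT l y d mu x) (j : Fin m) :
    Tendsto (fun i => P.con j (y i) + inner ℝ (P.g j (y i)) (d i)) l (𝓝 (P.con j x)) := by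
  simpa using (((hcon j).continuous.tendsto x).comp h.tendsto_point).add
    ((h.tendsto_g hcon j).inner h.tendsto_direction)

theorem tendsto_sum_smul (hobj : ContDiff ℝ 1 P.obj) (h : P.AsymptoticKKT l y d mu x) :
    Tendsto (fun i => ∑ j, mu i j • P.g j (y i)) l (𝓝 (-P.g₀ x)) := by
  simpa using h.tendsto_stationary.sub (h.tendsto_g₀ hobj)

theorem eventually_eq_zero_of_notMem_active [l.NeBot] (hcon : ∀ j, ContDiff ℝ 1 (P.con j))
    (h : P.AsymptoticKKT l y d mu x) : ∀ᶠ i in l, ∀ j ∉ P.active x, mu i j = 0 := by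
  refine eventually_all.2 fun j => eventually_imp_distrib_left.2 fun hj => ?_
  have hne : P.con j x ≠ 0 := by rwa [← P.conBar_eq_con (h.con_nonpos hcon j)]
  filter_upwards [(h.tendsto_linearization hcon j).eventually_ne hne, h.complementary]
    with i hi hcomp
  exact (mul_eq_zero.1 (hcomp j)).resolve_right hi

theorem exists_eventually_norm_le (hcon : ∀ j, ContDiff ℝ 1 (P.con j))
    (hind : LinearIndependent ℝ fun j : P.active x => P.g j x)
    (h : P.AsymptoticKKT l y d mu x) :
    ∃ C > 0, ∀ᶠ i in l, ∀ c : Fin m → ℝ, (∀ j ∉ P.active x, c j = 0) →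
      ‖c‖ ≤ C * ‖∑ j, c j • P.g j (y i)‖ :=
  exists_eventually_norm_le_mul_norm_sum_smul_of_support (l := l)
    (v := fun i j => P.g j (y i)) (w := fun j => P.g j x) hind (h.tendsto_g hcon)

theorem isKKTPair_of_tendsto [l.NeBot] (hobj : ContDiff ℝ 1 P.obj)
    (hcon : ∀ j, ContDiff ℝ 1 (P.con j)) (h : P.AsymptoticKKT l y d mu x)
    (hmu : Tendsto mu l (𝓝 lam)) : P.IsKKTPair x lam where
  stationary := tendsto_nhds_unique ((h.tendsto_g₀ hobj).add (tendsto_finsetSum _ fun j _ =>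
    (tendsto_pi_nhds.1 hmu j).smul (h.tendsto_g hcon j))) h.tendsto_stationary
  feasible := h.con_nonpos hcon
  nonneg j := ge_of_tendsto (tendsto_pi_nhds.1 hmu j) (h.nonneg.mono fun _ hi => hi j)
  complementary j := tendsto_nhds_unique_of_eventuallyEq
    ((tendsto_pi_nhds.1 hmu j).mul (h.tendsto_linearization hcon j)) tendsto_const_nhds
    (h.complementary.mono fun _ hi => hi j)

theorem exists_isKKTPair [l.NeBot] (hobj : ContDiff ℝ 1 P.obj)
    (hcon : ∀ j, ContDiff ℝ 1 (P.con j))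
    (hind : LinearIndependent ℝ fun j : P.active x => P.g j x)
    (h : P.AsymptoticKKT l y d mu x) : ∃ lam, P.IsKKTPair x lam := by
  obtain ⟨C, hC, hbound⟩ := h.exists_eventually_norm_le hcon hind
  have hmem : ∀ᶠ i in l, mu i ∈ Metric.closedBall (0 : Fin m → ℝ) (C * (‖-P.g₀ x‖ + 1)) := by
    filter_upwards [hbound, h.eventually_eq_zero_of_notMem_active hcon,
      (h.tendsto_sum_smul hobj).norm.eventually_le_const (lt_add_one _)] with i hi hzero hsum
    exact mem_closedBall_zero_iff.2 ((hi _ hzero).trans (by gcongr))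
  obtain ⟨lam, -, hlam⟩ := (isCompact_closedBall _ _).exists_mapClusterPt
    (tendsto_principal.2 hmem)
  obtain ⟨U, hU, hUlam⟩ := mapClusterPt_iff_ultrafilter.1 hlam
  exact ⟨lam, (h.mono hU).isKKTPair_of_tendsto hobj hcon hUlam⟩

theorem tendsto_multiplier [l.NeBot] (hobj : ContDiff ℝ 1 P.obj)
    (hcon : ∀ j, ContDiff ℝ 1 (P.con j))
    (hind : LinearIndependent ℝ fun j : P.active x => P.g j x)
    (h : P.AsymptoticKKT l y d mu x) (hlam : P.IsKKTPair x lam) : Tendsto mu l (𝓝 lam) := by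
  obtain ⟨C, -, hbound⟩ := h.exists_eventually_norm_le hcon hind
  have hlam_zero : ∀ j ∉ P.active x, lam j = 0 := fun j hj => by
    have hne : P.con j x ≠ 0 := by rwa [← P.conBar_eq_con (hlam.feasible j)]
    exact (mul_eq_zero.1 (hlam.complementary j)).resolve_right hne
  have hsum : Tendsto (fun i => ∑ j, (mu i - lam) j • P.g j (y i)) l (𝓝 0) := by
    have hlim := (h.tendsto_sum_smul hobj).sub
      (tendsto_finsetSum Finset.univ fun j _ => (h.tendsto_g hcon j).const_smul (lam j))
    rw [neg_sub_left, add_comm, hlam.stationary, neg_zero] at hlim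
    simpa only [Pi.sub_apply, sub_smul, Finset.sum_sub_distrib] using hlim
  rw [tendsto_iff_norm_sub_tendsto_zero]
  refine squeeze_zero' (.of_forall fun _ => norm_nonneg _) ?_
    (by simpa using hsum.norm.const_mul C)
  filter_upwards [hbound, h.eventually_eq_zero_of_notMem_active hcon] with i hi hzero
  exact hi _ fun j hj => by rw [Pi.sub_apply, hzero j hj, hlam_zero j hj, sub_zero]

end AsymptoticKKT

theorem IsKKTPair.unique (hobj : ContDiff ℝ 1 P.obj) (hcon : ∀ j, ContDiff ℝ 1 (P.con j))
    (hind : LinearIndependent ℝ fun j : P.active x => P.g j x) {lam' : Fin m → ℝ}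
    (h : P.IsKKTPair x lam) (h' : P.IsKKTPair x lam') : lam = lam' :=
  tendsto_nhds_unique tendsto_const_nhds
    ((asymptoticKKT_of_isKKTPair (l := (pure () : Filter Unit)) (y := fun _ => x)
      (mu := fun _ => lam) tendsto_const_nhds (.of_forall fun _ => h)).tendsto_multiplier
        hobj hcon hind h')

end KKT

section SecondOrder

variable {n m : ℕ} (P : Problem n m)

/-- The second-order sufficient condition at `(x, λ)`: the Hessian in `x` of the Lagrangian is
positive on the nonzero vectors of the critical cone. It weakens `SSOSC` by restricting the
directions further, to those along which no constraint with `f_j(x) = 0` increases. -/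
def SOSC (x : E n) (lam : Fin m → ℝ) : Prop :=
  ∀ d : E n, d ≠ 0 → (∀ j, P.con j x = 0 → inner ℝ (P.g j x) d ≤ 0) →
    (∀ j, 0 < lam j → inner ℝ (P.g j x) d = 0) →
      0 < fderiv ℝ (fderiv ℝ (P.lagrangian lam)) x d d

variable {P} {x y : E n} {lam mu : Fin m → ℝ}

theorem SSOSC.sosc (h : P.SSOSC x lam) : P.SOSC x lam := fun d hd _ => h d hd

theorem contDiff_lagrangian {k : WithTop ℕ∞} (hobj : ContDiff ℝ k P.obj)
    (hcon : ∀ j, ContDiff ℝ k (P.con j)) (lam : Fin m → ℝ) : ContDiff ℝ k (P.lagrangian lam) :=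
  hobj.add (ContDiff.sum fun j _ => contDiff_const.mul (hcon j))

theorem fderiv_lagrangian_apply (hobj : Differentiable ℝ P.obj)
    (hcon : ∀ j, Differentiable ℝ (P.con j)) (lam : Fin m → ℝ) (x d : E n) :
    fderiv ℝ (P.lagrangian lam) x d = inner ℝ (P.g₀ x + ∑ j, lam j • P.g j x) d := by
  have hderiv : HasFDerivAt (P.lagrangian lam)
      (fderiv ℝ P.obj x + ∑ j, lam j • fderiv ℝ (P.con j) x) x :=
    (hobj x).hasFDerivAt.add
      (HasFDerivAt.fun_sum fun j _ => (hcon j x).hasFDerivAt.const_mul (lam j))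
  rw [hderiv.fderiv]
  simp [inner_add_left, sum_inner, real_inner_smul_left, g₀, g, inner_gradient_left]

theorem IsKKTPair.fderiv_lagrangian_eq_zero (hobj : Differentiable ℝ P.obj)
    (hcon : ∀ j, Differentiable ℝ (P.con j)) (h : P.IsKKTPair x lam) :
    fderiv ℝ (P.lagrangian lam) x = 0 := by
  ext d
  rw [fderiv_lagrangian_apply hobj hcon, h.stationary]
  simp

theorem IsKKTPair.fderiv_lagrangian_apply_sub_le (hobj : Differentiable ℝ P.obj)
    (hcon : ∀ j, Differentiable ℝ (P.con j)) (hx : P.IsKKTPair x lam)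
    (hy : P.IsKKTPair y mu) :
    fderiv ℝ (P.lagrangian lam) y (y - x) ≤
      ∑ j, |mu j - lam j| * |P.con j x - P.con j y - inner ℝ (P.g j y) (x - y)| := by
  have hdiff : fderiv ℝ (P.lagrangian lam) y (y - x) =
      ∑ j, (mu j - lam j) * inner ℝ (P.g j y) (x - y) := by
    rw [← sub_zero (fderiv ℝ _ y), ← hy.fderiv_lagrangian_eq_zero hobj hcon,
      sub_apply, fderiv_lagrangian_apply hobj hcon,
      fderiv_lagrangian_apply hobj hcon, ← inner_sub_left, add_sub_add_left_eq_sub,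
      ← Finset.sum_sub_distrib, sum_inner]
    refine Finset.sum_congr rfl fun j _ => ?_
    rw [← sub_smul, real_inner_smul_left, ← neg_sub x y, inner_neg_right]
    ring
  rw [hdiff]
  refine Finset.sum_le_sum fun j _ => ?_
  have hcompl : 0 ≤ (mu j - lam j) * (P.con j y - P.con j x) := by
    linarith [hx.complementary j, hy.complementary j,
      mul_nonpos_of_nonneg_of_nonpos (hx.nonneg j) (hy.feasible j),
      mul_nonpos_of_nonneg_of_nonpos (hy.nonneg j) (hx.feasible j)]
  rw [← abs_mul]
  refine le_trans ?_ (neg_le_abs _)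
  linarith

variable {l : Filter (E n)} {d : E n} {mu : E n → Fin m → ℝ}

theorem inner_nonpos_of_tendsto_normalized_sub [l.NeBot] {j : Fin m}
    (hcon : Differentiable ℝ (P.con j)) (hl : l ≤ 𝓝 x)
    (hd : Tendsto (fun y => ‖y - x‖⁻¹ • (y - x)) l (𝓝 d))
    (hfeas : ∀ᶠ y in l, P.con j y ≤ 0) (hj : P.con j x = 0) : inner ℝ (P.g j x) d ≤ 0 := by
  have hlim := tendsto_normalized_sub_of_hasFDerivAt (hcon x).hasFDerivAt hl hd
  rw [g, inner_gradient_left]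
  refine le_of_tendsto hlim (hfeas.mono fun y hy => ?_)
  rw [hj, sub_zero]
  exact mul_nonpos_of_nonneg_of_nonpos (by positivity) hy

theorem inner_eq_zero_of_tendsto_normalized_sub [l.NeBot] {j : Fin m}
    (hcon : Differentiable ℝ (P.con j)) (hl : l ≤ 𝓝 x)
    (hd : Tendsto (fun y => ‖y - x‖⁻¹ • (y - x)) l (𝓝 d))
    (hzero : ∀ᶠ y in l, P.con j y = 0) (hj : P.con j x = 0) : inner ℝ (P.g j x) d = 0 := by
  have hlim := tendsto_normalized_sub_of_hasFDerivAt (hcon x).hasFDerivAt hl hd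
  rw [g, inner_gradient_left]
  refine tendsto_nhds_unique_of_eventuallyEq hlim tendsto_const_nhds (hzero.mono fun y hy => ?_)
  simp only [hy, hj, sub_zero, smul_zero]

theorem IsKKTPair.fderiv_fderiv_lagrangian_nonpos [l.NeBot] (hobj : ContDiff ℝ 2 P.obj)
    (hcon : ∀ j, ContDiff ℝ 2 (P.con j)) (hx : P.IsKKTPair x lam) (hl : l ≤ 𝓝[≠] x)
    (hmu : Tendsto mu l (𝓝 lam)) (hkkt : ∀ᶠ y in l, P.IsKKTPair y (mu y))
    (hd : Tendsto (fun y => ‖y - x‖⁻¹ • (y - x)) l (𝓝 d)) :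
    fderiv ℝ (fderiv ℝ (P.lagrangian lam)) x d d ≤ 0 := by
  have hl' : l ≤ 𝓝 x := hl.trans nhdsWithin_le_nhds
  have hobj' := hobj.differentiable two_ne_zero
  have hcon' := fun j => (hcon j).differentiable two_ne_zero
  set F := fderiv ℝ (P.lagrangian lam)
  have hF : HasFDerivAt F (fderiv ℝ F x) x :=
    (((contDiff_lagrangian hobj hcon lam).fderiv_right (m := 1) (by norm_num)).differentiable
      one_ne_zero x).hasFDerivAt
  choose M hM using fun j =>
    exists_taylor_bound (hcon j) (isCompact_closedBall x 1) (convex_closedBall x 1)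
  have hlim : Tendsto (fun y => ∑ j, |mu y j - lam j| * M j) l (𝓝 0) := by
    simpa using tendsto_finsetSum Finset.univ fun j _ =>
      ((tendsto_pi_nhds.1 hmu j).sub_const (lam j)).abs.mul_const (M j)
  refine le_of_tendsto_of_tendsto
    (tendsto_inv_sq_mul_apply_sub hF (hx.fderiv_lagrangian_eq_zero hobj' hcon') hl' hd) hlim ?_
  filter_upwards [hkkt, hl self_mem_nhdsWithin, hl' (Metric.closedBall_mem_nhds x one_pos)]
    with y hy hne hball
  have hr : 0 < ‖y - x‖ := norm_pos_iff.2 (sub_ne_zero.2 hne)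
  refine (inv_mul_le_iff₀' (by positivity)).2
    ((hx.fderiv_lagrangian_apply_sub_le hobj' hcon' hy).trans ?_)
  rw [Finset.sum_mul]
  refine Finset.sum_le_sum fun j _ => ?_
  rw [mul_assoc, norm_sub_rev]
  gcongr
  exact hM j y hball x (Metric.mem_closedBall_self zero_le_one)

theorem SOSC.eventually_not_isKKTPair (hobj : ContDiff ℝ 2 P.obj)
    (hcon : ∀ j, ContDiff ℝ 2 (P.con j))
    (hind : LinearIndependent ℝ fun j : P.active x => P.g j x) (hsosc : P.SOSC x lam)
    (hx : P.IsKKTPair x lam) : ∀ᶠ y in 𝓝[≠] x, ¬ ∃ mu, P.IsKKTPair y mu := by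
  by_contra hfreq
  obtain ⟨U, hU, hkkt, d, hd, hUd⟩ :=
    exists_tendsto_normalized_sub_of_frequently (not_eventually.1 hfreq |>.mono fun _ => not_not.1)
  obtain ⟨mu, hmu⟩ := hkkt.choice
  have hU' : (U : Filter (E n)) ≤ 𝓝 x := hU.trans nhdsWithin_le_nhds
  have hlim : Tendsto mu U (𝓝 lam) :=
    (asymptoticKKT_of_isKKTPair (tendsto_id'.2 hU') hmu).tendsto_multiplier
      (hobj.of_le one_le_two) (fun j => (hcon j).of_le one_le_two) hind hx
  refine (hx.fderiv_fderiv_lagrangian_nonpos hobj hcon hU hlim hmu hUd).not_gt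
    (hsosc d hd (fun j hj => ?_) fun j hj => ?_)
  · exact inner_nonpos_of_tendsto_normalized_sub ((hcon j).differentiable two_ne_zero) hU' hUd
      (hmu.mono fun y hy => hy.feasible j) hj
  · refine inner_eq_zero_of_tendsto_normalized_sub ((hcon j).differentiable two_ne_zero) hU' hUd
      ?_ ((mul_eq_zero.1 (hx.complementary j)).resolve_left hj.ne')
    filter_upwards [hmu, (tendsto_pi_nhds.1 hlim j).eventually_const_lt hj] with y hy hpos
    exact (mul_eq_zero.1 (hy.complementary j)).resolve_left hpos.ne'

end SecondOrder

end Problem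

theorem Params.σ_pos (p : Params) : 0 < p.σ := p.θ_pos.trans p.θ_lt

theorem Params.θ_lt_one (p : Params) : p.θ < 1 := p.θ_lt.trans p.σ_lt

section ConvexCombination

variable {n m : ℕ} {P : Problem n m} {p : Params} {x d₀ dt : E n}

theorem Problem.rpow_phi_nonneg (P : Problem n m) (x : E n) (r : ℝ) : 0 ≤ P.phi x ^ r :=
  Real.rpow_nonneg (P.phi_nonneg x) r

theorem beta_le_one : beta P p x d₀ dt ≤ 1 := by
  unfold beta
  split_ifs
  · exact min_le_left _ _
  · exact le_rfl

theorem le_beta {z : ℝ} (hz : z ≤ 1)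
    (h : z * (inner ℝ (P.g₀ x) dt - inner ℝ (P.g₀ x) d₀) ≤
      (p.θ - 1) * inner ℝ (P.g₀ x) d₀ + P.phi x ^ p.θ) : z ≤ beta P p x d₀ dt := by
  unfold beta
  split_ifs with hlt
  · exact le_min hz ((le_div_iff₀ (sub_pos.2 hlt)).2 h)
  · exact hz

theorem beta_nonneg (h : inner ℝ (P.g₀ x) d₀ ≤ 0) : 0 ≤ beta P p x d₀ dt := by
  refine le_beta zero_le_one ?_
  have hφ := P.rpow_phi_nonneg x p.θ
  linarith [mul_nonneg_of_nonpos_of_nonpos (sub_nonpos.2 p.θ_lt_one.le) h]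

theorem inner_beta_combination_le (h : inner ℝ (P.g₀ x) d₀ ≤ 0) :
    inner ℝ (P.g₀ x) ((1 - beta P p x d₀ dt) • d₀ + beta P p x d₀ dt • dt) ≤
      p.θ * inner ℝ (P.g₀ x) d₀ + P.phi x ^ p.θ := by
  rw [inner_add_right, inner_smul_right, inner_smul_right]
  have hφ := P.rpow_phi_nonneg x p.θ
  by_cases hlt : inner ℝ (P.g₀ x) d₀ < inner ℝ (P.g₀ x) dt
  · have hβ := (beta.eq_1 P p x d₀ dt).trans_le ((if_pos hlt).trans_le (min_le_right _ _))
    rw [le_div_iff₀ (sub_pos.2 hlt)] at hβ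
    linarith
  · rw [beta, if_neg hlt]
    linarith [mul_nonneg_of_nonpos_of_nonpos (sub_nonpos.2 p.θ_lt_one.le) h]

theorem norm_beta_combination_le (h : inner ℝ (P.g₀ x) d₀ ≤ 0) :
    ‖(1 - beta P p x d₀ dt) • d₀ + beta P p x d₀ dt • dt‖ ≤ ‖d₀‖ + ‖dt‖ := by
  have h0 : 0 ≤ beta P p x d₀ dt := beta_nonneg h
  have h1 : beta P p x d₀ dt ≤ 1 := beta_le_one
  refine (norm_add_le _ _).trans (add_le_add ?_ ?_)
  · rw [norm_smul, Real.norm_of_nonneg (sub_nonneg.2 h1)]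
    exact mul_le_of_le_one_left (norm_nonneg _) (sub_le_self 1 h0)
  · rw [norm_smul, Real.norm_of_nonneg h0]
    exact mul_le_of_le_one_left (norm_nonneg _) h1

end ConvexCombination

section RunBounds

variable {n m : ℕ} {P : Problem n m} {p : Params} {s : Sequences n m}

/-- The matrix `B` has coercivity constant `a` and operator norm at most `b`. -/
def IsFormBounded (a b : ℝ) (B : Matrix (Fin n) (Fin n) ℝ) : Prop :=
  ∀ d : E n, a * ‖d‖ ^ 2 ≤ inner ℝ d (B.toEuclideanLin d) ∧ ‖B.toEuclideanLin d‖ ≤ b * ‖d‖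

theorem UniformlyPosDef.exists_isFormBounded {B : ℕ → Matrix (Fin n) (Fin n) ℝ}
    (hB : UniformlyPosDef B) (hpos : ∀ k, (B k).PosDef) :
    ∃ a > 0, ∃ b ≥ 0, ∀ k, IsFormBounded a b (B k) := by
  obtain ⟨a, b, ha, hb, hab⟩ := hB
  refine ⟨a, ha, b, hb.le, fun k d => ⟨(hab k d).1,
    norm_apply_le_of_form_le
      (Matrix.isSymmetric_toEuclideanLin_iff.2 (hpos k).isHermitian)
      (fun d => le_trans (by positivity) (hab k d).1) (fun d => (hab k d).2) d⟩⟩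

theorem Problem.IsQPMultiplier.inner_g₀_le {B : Matrix (Fin n) (Fin n) ℝ} {x d₀ : E n}
    {lam : Fin m → ℝ} (h : P.IsQPMultiplier B x d₀ lam) :
    inner ℝ (P.g₀ x) d₀ ≤ -inner ℝ d₀ (B.toEuclideanLin d₀) := by
  have hzero := congrArg (inner ℝ · d₀) h.stationary
  simp only [inner_add_left, sum_inner, real_inner_smul_left, inner_zero_left] at hzero
  have hsum : 0 ≤ ∑ j, lam j * inner ℝ (P.g j x) d₀ := Finset.sum_nonneg fun j _ => by
    linarith [h.complementary j,
      mul_nonpos_of_nonneg_of_nonpos (h.nonneg j) (P.conBar_nonpos j x)]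
  rw [real_inner_comm (B.toEuclideanLin d₀)]
  linarith

/-- The size `‖d₀‖ + φ^σ` of the right-hand side of the linear system for `dt`. -/
noncomputable def residual (P : Problem n m) (p : Params) (s : Sequences n m) (k : ℕ) : ℝ :=
  ‖s.d₀ k‖ + P.phi (s.x k) ^ p.σ

/-- The weight `β_k` of `dt` in the convex combination `q`. -/
noncomputable def weight (P : Problem n m) (p : Params) (s : Sequences n m) (k : ℕ) : ℝ :=
  beta P p (s.x k) (s.d₀ k) (s.dt k)

theorem norm_d₀_le_residual (k : ℕ) : ‖s.d₀ k‖ ≤ residual P p s k :=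
  le_add_of_nonneg_right (P.rpow_phi_nonneg _ _)

theorem rpow_phi_le_residual (k : ℕ) : P.phi (s.x k) ^ p.σ ≤ residual P p s k :=
  le_add_of_nonneg_left (norm_nonneg _)

theorem residual_nonneg (k : ℕ) : 0 ≤ residual P p s k :=
  (norm_nonneg _).trans (norm_d₀_le_residual k)

/-- Estimates that hold uniformly along the run; a single constant `V` serves as upper bound for
all quantities and as second-order Taylor constant along the segments `[x, x + q]`. -/
structure RunBounds (P : Problem n m) (p : Params) (s : Sequences n m) (a V : ℝ) : Prop where
  a_pos : 0 < a
  one_le : 1 ≤ V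
  descent : ∀ k, inner ℝ (P.g₀ (s.x k)) (s.d₀ k) ≤ -(a * ‖s.d₀ k‖ ^ 2)
  norm_g₀_le : ∀ k, ‖P.g₀ (s.x k)‖ ≤ V
  norm_g_le : ∀ j k, ‖P.g j (s.x k)‖ ≤ V
  phi_le : ∀ k, P.phi (s.x k) ≤ V
  abs_conBar_le : ∀ j k, |P.conBar j (s.x k)| ≤ V
  norm_d₀_le : ∀ k, ‖s.d₀ k‖ ≤ V
  norm_d₁_le : ∀ k, ‖s.d₁ k‖ ≤
    V * (‖s.d₀ k‖ ^ p.τ + P.phi (s.x k) ^ p.σ + V * ‖s.d₀ k‖ ^ 2)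
  norm_dt_le : ∀ k, ‖s.dt k‖ ≤ V * residual P p s k
  norm_ht_le : ∀ k, ‖s.ht k‖ ≤ V * residual P p s k
  taylor_obj : ∀ k, ∀ t ∈ Set.Icc (0 : ℝ) 1,
    |P.obj (s.x k + t • s.q k) - P.obj (s.x k) - t * inner ℝ (P.g₀ (s.x k)) (s.q k)| ≤
      V * t ^ 2 * ‖s.q k‖ ^ 2
  taylor_con : ∀ j k, ∀ t ∈ Set.Icc (0 : ℝ) 1,
    |P.con j (s.x k + t • s.q k) - P.con j (s.x k) - t * inner ℝ (P.g j (s.x k)) (s.q k)| ≤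
      V * t ^ 2 * ‖s.q k‖ ^ 2

theorem eventually_forall_abs_conBar_le (hcon : ∀ j, Continuous (P.con j))
    (hbdd : Bornology.IsBounded (Set.range s.x)) :
    ∀ᶠ V in atTop, ∀ j k, |P.conBar j (s.x k)| ≤ V := by
  refine eventually_all.2 fun j => ?_
  filter_upwards [eventually_forall_norm_le ((hcon j).abs.add (P.continuous_phi hcon)) hbdd]
    with V hV k
  exact ((P.abs_conBar_le j _).trans (Real.le_norm_self _)).trans (hV k)

theorem eventually_forall_abs_remainder_le (hcon : ∀ j, ContDiff ℝ 2 (P.con j))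
    (hbdd : Bornology.IsBounded (Set.range s.x)) (hd₀ : Bornology.IsBounded (Set.range s.d₀)) :
    ∀ᶠ M in atTop, ∀ j k, |P.remainder (s.x k) (s.d₀ k) j| ≤ M * ‖s.d₀ k‖ ^ 2 := by
  refine eventually_all.2 fun j => ?_
  filter_upwards [eventually_forall_taylor_bound (hcon j) hbdd hd₀] with M hM k
  simpa only [Problem.remainder, Problem.g, one_smul, one_mul, one_pow, mul_one] using
    hM k 1 (Set.right_mem_Icc.2 zero_le_one)

theorem isBounded_range_d₀ (hobj : ContDiff ℝ 1 P.obj)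
    (hbdd : Bornology.IsBounded (Set.range s.x)) {a : ℝ} (ha : 0 < a)
    (hdescent : ∀ k, inner ℝ (P.g₀ (s.x k)) (s.d₀ k) ≤ -(a * ‖s.d₀ k‖ ^ 2)) :
    Bornology.IsBounded (Set.range s.d₀) := by
  obtain ⟨V, hV⟩ := (eventually_forall_norm_le (P.continuous_g₀ hobj) hbdd).exists
  refine isBounded_iff_forall_norm_le.2 ⟨V / a, Set.forall_mem_range.2 fun k => ?_⟩
  exact (le_div_iff₀' ha).2 ((mul_norm_le_of_inner_le (hdescent k)).trans (hV k))

namespace IsGenerated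

theorem inner_g₀_d₀_le (hs : IsGenerated P p s) {a b : ℝ} {k : ℕ}
    (hB : IsFormBounded a b (s.B k)) :
    inner ℝ (P.g₀ (s.x k)) (s.d₀ k) ≤ -(a * ‖s.d₀ k‖ ^ 2) :=
  (hs.qp_multiplier k).inner_g₀_le.trans (neg_le_neg (hB _).1)

theorem norm_dt_ht_le (hs : IsGenerated P p s) {a b C : ℝ} (hC : 0 ≤ C) {k : ℕ}
    (hB : IsFormBounded a b (s.B k)) (hbound : P.IsSLEBound a b C (s.x k)) :
    ‖s.dt k‖ ≤ C * residual P p s k ∧ ‖s.ht k‖ ≤ C * residual P p s k := by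
  have hr : ‖fun _ : Fin m => -residual P p s k‖ ≤ residual P p s k :=
    (pi_norm_const_le _).trans_eq (by rw [norm_neg, Real.norm_of_nonneg (residual_nonneg k)])
  have hle := hbound (hB _).1 (hB _).2 (hs.updated k)
  exact ⟨hle.1.trans (by gcongr; exact hr), hle.2.trans (by gcongr; exact hr)⟩

theorem norm_d₁_le (hs : IsGenerated P p s) {a b C M : ℝ} (hC : 0 ≤ C) {k : ℕ}
    (hB : IsFormBounded a b (s.B k)) (hbound : P.IsSLEBound a b C (s.x k)) (hM : 0 ≤ M)
    (hrem : ∀ j, |P.remainder (s.x k) (s.d₀ k) j| ≤ M * ‖s.d₀ k‖ ^ 2) :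
    ‖s.d₁ k‖ ≤ C * (‖s.d₀ k‖ ^ p.τ + P.phi (s.x k) ^ p.σ + M * ‖s.d₀ k‖ ^ 2) := by
  have hmain : 0 ≤ ‖s.d₀ k‖ ^ p.τ + P.phi (s.x k) ^ p.σ :=
    add_nonneg (by positivity) (P.rpow_phi_nonneg _ _)
  refine (hbound (hB _).1 (hB _).2 (hs.correction k)).1.trans ?_
  gcongr
  refine (pi_norm_le_iff_of_nonneg (by positivity)).2 fun j => ?_
  refine (norm_sub_le _ _).trans (add_le_add ?_ (hrem j))
  rw [norm_neg, Real.norm_of_nonneg hmain]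

theorem isBounded_range_q (hs : IsGenerated P p s)
    (hd₀ : Bornology.IsBounded (Set.range s.d₀)) (hdt : Bornology.IsBounded (Set.range s.dt))
    (hdescent : ∀ k, inner ℝ (P.g₀ (s.x k)) (s.d₀ k) ≤ 0) :
    Bornology.IsBounded (Set.range s.q) := by
  obtain ⟨R, hR⟩ := isBounded_iff_forall_norm_le.1 hd₀
  obtain ⟨S, hS⟩ := isBounded_iff_forall_norm_le.1 hdt
  refine isBounded_iff_forall_norm_le.2 ⟨R + S, Set.forall_mem_range.2 fun k => ?_⟩
  rw [hs.combination k]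
  exact (norm_beta_combination_le (hdescent k)).trans
    (add_le_add (hR _ ⟨k, rfl⟩) (hS _ ⟨k, rfl⟩))

theorem isBounded_range_dt (hs : IsGenerated P p s) (hcon : ∀ j, ContDiff ℝ 1 (P.con j))
    (hind : P.GradientsIndependent) (hbdd : Bornology.IsBounded (Set.range s.x))
    (hd₀ : Bornology.IsBounded (Set.range s.d₀)) {a b : ℝ} (ha : 0 < a) (hb : 0 ≤ b)
    (hB : ∀ k, IsFormBounded a b (s.B k)) : Bornology.IsBounded (Set.range s.dt) := by
  have hphi := (P.continuous_phi fun j => (hcon j).continuous).rpow_const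
    (p := p.σ) fun _ => Or.inr p.σ_pos.le
  obtain ⟨V, hV, hphi, hbound⟩ := ((eventually_ge_atTop 0).and
    ((eventually_forall_norm_le hphi hbdd).and
      (P.eventually_forall_isSLEBound hcon hind ha hb hbdd.isCompact_closure))).exists
  obtain ⟨R, hR⟩ := isBounded_iff_forall_norm_le.1 hd₀
  refine isBounded_iff_forall_norm_le.2 ⟨V * (R + V), Set.forall_mem_range.2 fun k => ?_⟩
  refine (hs.norm_dt_ht_le hV (hB k) (hbound _ (subset_closure ⟨k, rfl⟩))).1.trans ?_
  unfold residual
  gcongr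
  · exact hR _ ⟨k, rfl⟩
  · exact (Real.le_norm_self _).trans (hphi k)

theorem exists_runBounds (hs : IsGenerated P p s) (hobj : ContDiff ℝ 2 P.obj)
    (hcon : ∀ j, ContDiff ℝ 2 (P.con j)) (hind : P.GradientsIndependent)
    (hB : UniformlyPosDef s.B) (hbdd : Bornology.IsBounded (Set.range s.x)) :
    ∃ a V, RunBounds P p s a V := by
  obtain ⟨a, ha, b, hb, hB⟩ := hB.exists_isFormBounded hs.posDef
  have hobj₁ : ContDiff ℝ 1 P.obj := hobj.of_le one_le_two
  have hcon₁ : ∀ j, ContDiff ℝ 1 (P.con j) := fun j => (hcon j).of_le one_le_two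
  have hcon₀ : ∀ j, Continuous (P.con j) := fun j => (hcon j).continuous
  have hdescent := fun k => hs.inner_g₀_d₀_le (hB k)
  have hd₀ := isBounded_range_d₀ hobj₁ hbdd ha hdescent
  have hq := hs.isBounded_range_q hd₀ (hs.isBounded_range_dt hcon₁ hind hbdd hd₀ ha hb hB)
    fun k => (hdescent k).trans (neg_nonpos.2 (by positivity))
  obtain ⟨V, hV, hg₀, hg, hφ, hbar, hd₀V, hsle, hobj_q, hcon_q, hrem⟩ :=
    ((eventually_ge_atTop 1).and ((eventually_forall_norm_le (P.continuous_g₀ hobj₁) hbdd).and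
      ((eventually_all.2 fun j =>
          eventually_forall_norm_le (P.continuous_g (hcon₁ j)) hbdd).and
      ((eventually_forall_norm_le (P.continuous_phi hcon₀) hbdd).and
      ((eventually_forall_abs_conBar_le hcon₀ hbdd).and
      ((eventually_forall_norm_le continuous_id hd₀).and
      ((P.eventually_forall_isSLEBound hcon₁ hind ha hb hbdd.isCompact_closure).and
      ((eventually_forall_taylor_bound hobj hbdd hq).and
      ((eventually_all.2 fun j => eventually_forall_taylor_bound (hcon j) hbdd hq).and
      (eventually_forall_abs_remainder_le hcon hbdd hd₀)))))))))).exists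
  have hV₀ : 0 ≤ V := zero_le_one.trans hV
  have hbound : ∀ k, P.IsSLEBound a b V (s.x k) := fun k => hsle _ (subset_closure ⟨k, rfl⟩)
  exact ⟨a, V, {
    a_pos := ha
    one_le := hV
    descent := hdescent
    norm_g₀_le := hg₀
    norm_g_le := hg
    phi_le := fun k => (Real.le_norm_self _).trans (hφ k)
    abs_conBar_le := hbar
    norm_d₀_le := hd₀V
    norm_d₁_le := fun k => hs.norm_d₁_le hV₀ (hB k) (hbound k) hV₀ fun j => hrem j k
    norm_dt_le := fun k => (hs.norm_dt_ht_le hV₀ (hB k) (hbound k)).1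
    norm_ht_le := fun k => (hs.norm_dt_ht_le hV₀ (hB k) (hbound k)).2
    taylor_obj := hobj_q
    taylor_con := hcon_q }⟩

end IsGenerated

end RunBounds

section LineSearch

variable {n m : ℕ} {P : Problem n m} {p : Params} {s : Sequences n m} {a V : ℝ}

namespace RunBounds

theorem inner_d₀_nonpos (hr : RunBounds P p s a V) (k : ℕ) :
    inner ℝ (P.g₀ (s.x k)) (s.d₀ k) ≤ 0 := by
  have ha := hr.a_pos
  exact (hr.descent k).trans (neg_nonpos.2 (by positivity))

theorem weight_nonneg (hr : RunBounds P p s a V) (k : ℕ) : 0 ≤ weight P p s k :=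
  beta_nonneg (hr.inner_d₀_nonpos k)

theorem rpow_phi_σ_le (hr : RunBounds P p s a V) (k : ℕ) : P.phi (s.x k) ^ p.σ ≤ V := by
  simpa using rpow_le_mul_rpow (P.phi_nonneg _) (hr.phi_le k) hr.one_le le_rfl p.σ_pos.le
    (by linarith [p.σ_lt])

theorem rpow_phi_σ_le_mul (hr : RunBounds P p s a V) (k : ℕ) :
    P.phi (s.x k) ^ p.σ ≤ V * P.phi (s.x k) ^ p.θ :=
  rpow_le_mul_rpow (P.phi_nonneg _) (hr.phi_le k) hr.one_le p.θ_pos.le p.θ_lt.le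
    (by linarith [p.σ_lt, p.θ_pos])

theorem residual_le (hr : RunBounds P p s a V) (k : ℕ) : residual P p s k ≤ 2 * V := by
  unfold residual
  linarith [hr.norm_d₀_le k, hr.rpow_phi_σ_le k]

theorem sq_residual_le (hr : RunBounds P p s a V) (k : ℕ) :
    residual P p s k ^ 2 ≤ 2 * V ^ 2 * (‖s.d₀ k‖ ^ 2 + P.phi (s.x k) ^ p.θ) := by
  have hV : 0 ≤ V := zero_le_one.trans hr.one_le
  have hφ : (P.phi (s.x k) ^ p.σ) ^ 2 ≤ V ^ 2 * P.phi (s.x k) ^ p.θ := by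
    have := P.rpow_phi_nonneg (s.x k) p.σ
    calc (P.phi (s.x k) ^ p.σ) ^ 2 = P.phi (s.x k) ^ p.σ * P.phi (s.x k) ^ p.σ := sq _
      _ ≤ V * (V * P.phi (s.x k) ^ p.θ) := by
        gcongr
        exacts [hr.rpow_phi_σ_le k, hr.rpow_phi_σ_le_mul k]
      _ = V ^ 2 * P.phi (s.x k) ^ p.θ := by ring
  have hd₀ : ‖s.d₀ k‖ ^ 2 ≤ V ^ 2 * ‖s.d₀ k‖ ^ 2 :=
    le_mul_of_one_le_left (sq_nonneg _) (one_le_pow₀ hr.one_le)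
  calc residual P p s k ^ 2 ≤ 2 * (‖s.d₀ k‖ ^ 2 + (P.phi (s.x k) ^ p.σ) ^ 2) := add_sq_le
    _ ≤ 2 * V ^ 2 * (‖s.d₀ k‖ ^ 2 + P.phi (s.x k) ^ p.θ) := by linarith

theorem norm_q_le (hr : RunBounds P p s a V) (hs : IsGenerated P p s) (k : ℕ) :
    ‖s.q k‖ ≤ (1 + V) * residual P p s k := by
  rw [hs.combination k]
  have hq := norm_beta_combination_le (p := p) (dt := s.dt k) (hr.inner_d₀_nonpos k)
  linarith [hr.norm_dt_le k, norm_d₀_le_residual (P := P) (p := p) (s := s) k]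

theorem inner_q_le (hr : RunBounds P p s a V) (hs : IsGenerated P p s) (k : ℕ) :
    inner ℝ (P.g₀ (s.x k)) (s.q k) ≤ P.phi (s.x k) ^ p.θ - p.θ * a * ‖s.d₀ k‖ ^ 2 := by
  have hq := inner_beta_combination_le (p := p) (dt := s.dt k) (hr.inner_d₀_nonpos k)
  rw [← hs.combination k] at hq
  linarith [mul_le_mul_of_nonneg_left (hr.descent k) p.θ_pos.le]

theorem sq_add_le_mul (hr : RunBounds P p s a V) (k : ℕ) :
    min ((1 - p.θ) * a) 1 * (residual P p s k ^ 2 + P.phi (s.x k) ^ p.σ) ≤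
      3 * V ^ 2 * ((p.θ - 1) * inner ℝ (P.g₀ (s.x k)) (s.d₀ k) + P.phi (s.x k) ^ p.θ) := by
  set c := min ((1 - p.θ) * a) 1
  have hc : 0 ≤ c := le_min (mul_nonneg (sub_nonneg.2 p.θ_lt_one.le) hr.a_pos.le) zero_le_one
  have hφ := P.rpow_phi_nonneg (s.x k) p.θ
  have hσ : P.phi (s.x k) ^ p.σ ≤ V ^ 2 * (‖s.d₀ k‖ ^ 2 + P.phi (s.x k) ^ p.θ) := by
    have hV : V ≤ V ^ 2 := le_self_pow₀ hr.one_le two_ne_zero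
    refine (hr.rpow_phi_σ_le_mul k).trans ?_
    gcongr
    exact le_add_of_nonneg_left (sq_nonneg _)
  have hN : c * (‖s.d₀ k‖ ^ 2 + P.phi (s.x k) ^ p.θ) ≤
      (p.θ - 1) * inner ℝ (P.g₀ (s.x k)) (s.d₀ k) + P.phi (s.x k) ^ p.θ := by
    have hdescent := mul_le_mul_of_nonneg_left (hr.descent k) (sub_nonneg.2 p.θ_lt_one.le)
    have hca := mul_le_mul_of_nonneg_right (min_le_left _ _ : c ≤ _) (sq_nonneg ‖s.d₀ k‖)
    have hc1 := mul_le_mul_of_nonneg_right (min_le_right _ _ : c ≤ _) hφ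
    linarith
  calc c * (residual P p s k ^ 2 + P.phi (s.x k) ^ p.σ)
    _ ≤ c * (3 * V ^ 2 * (‖s.d₀ k‖ ^ 2 + P.phi (s.x k) ^ p.θ)) := by
      gcongr
      linarith [hr.sq_residual_le k]
    _ = 3 * V ^ 2 * (c * (‖s.d₀ k‖ ^ 2 + P.phi (s.x k) ^ p.θ)) := by ring
    _ ≤ _ := by gcongr

theorem inner_dt_sub_inner_d₀_le (hr : RunBounds P p s a V) (k : ℕ) :
    inner ℝ (P.g₀ (s.x k)) (s.dt k) - inner ℝ (P.g₀ (s.x k)) (s.d₀ k) ≤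
      2 * V ^ 2 * residual P p s k := by
  have hV := hr.one_le
  have hS : 0 ≤ residual P p s k := residual_nonneg k
  have hsub : ‖s.dt k - s.d₀ k‖ ≤ (V + 1) * residual P p s k := by
    linarith [norm_sub_le (s.dt k) (s.d₀ k), hr.norm_dt_le k,
      norm_d₀_le_residual (P := P) (p := p) (s := s) k]
  calc inner ℝ (P.g₀ (s.x k)) (s.dt k) - inner ℝ (P.g₀ (s.x k)) (s.d₀ k)
    _ = inner ℝ (P.g₀ (s.x k)) (s.dt k - s.d₀ k) := (inner_sub_right _ _ _).symm
    _ ≤ ‖P.g₀ (s.x k)‖ * ‖s.dt k - s.d₀ k‖ := real_inner_le_norm _ _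
    _ ≤ V * ((V + 1) * residual P p s k) := by
      gcongr
      exact hr.norm_g₀_le k
    _ ≤ 2 * V ^ 2 * residual P p s k := by
      rw [← mul_assoc]
      exact mul_le_mul_of_nonneg_right (by nlinarith) hS

theorem exists_le_weight_mul (hr : RunBounds P p s a V) : ∃ c > 0, ∀ k,
    c * (residual P p s k ^ 2 + P.phi (s.x k) ^ p.σ) ≤ weight P p s k * residual P p s k := by
  have hV : 0 < V := one_pos.trans_le hr.one_le
  set e := min ((1 - p.θ) * a) 1
  have he : 0 < e := lt_min (mul_pos (sub_pos.2 p.θ_lt_one) hr.a_pos) one_pos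
  refine ⟨e / (6 * V ^ 4), by positivity, fun k => ?_⟩
  set c := e / (6 * V ^ 4)
  have hφS : P.phi (s.x k) ^ p.σ ≤ residual P p s k := rpow_phi_le_residual k
  have hφ := P.rpow_phi_nonneg (s.x k) p.σ
  rcases (hφ.trans hφS).eq_or_lt with hS | hS
  · rw [← hS] at hφS ⊢
    simp [le_antisymm hφS hφ]
  rw [← div_le_iff₀ hS]
  refine le_beta ((div_le_one hS).2 ?_) ?_
  · have hc : c * (6 * V) ≤ 1 := by
      have : e * V ≤ 1 * V ^ 4 := by
        gcongr
        exacts [min_le_right _ _, le_self_pow₀ hr.one_le (by norm_num)]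
      rw [div_mul_eq_mul_div, div_le_one (by positivity)]
      linarith
    calc c * (residual P p s k ^ 2 + P.phi (s.x k) ^ p.σ)
      _ ≤ c * (2 * V * residual P p s k + V * residual P p s k) := by
        gcongr
        · rw [sq]
          gcongr
          exact hr.residual_le k
        · exact hφS.trans (le_mul_of_one_le_left hS.le hr.one_le)
      _ = c * (6 * V) * residual P p s k / 2 := by ring
      _ ≤ residual P p s k := by linarith [mul_le_mul_of_nonneg_right hc hS.le]
  · calc c * (residual P p s k ^ 2 + P.phi (s.x k) ^ p.σ) / residual P p s k *
          (inner ℝ (P.g₀ (s.x k)) (s.dt k) - inner ℝ (P.g₀ (s.x k)) (s.d₀ k))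
      _ ≤ c * (residual P p s k ^ 2 + P.phi (s.x k) ^ p.σ) / residual P p s k *
          (2 * V ^ 2 * residual P p s k) := by
        gcongr
        exact hr.inner_dt_sub_inner_d₀_le k
      _ = e * (residual P p s k ^ 2 + P.phi (s.x k) ^ p.σ) / (3 * V ^ 2) := by
        simp only [c]
        field_simp
        norm_num
      _ ≤ _ := (div_le_iff₀' (by positivity)).2 (hr.sq_add_le_mul k)

theorem diagD_mul_ht_le (hr : RunBounds P p s a V) (j : Fin m) (k : ℕ) :
    P.diagD (s.x k) (s.d₀ k) j * s.ht k j ≤ 6 * V ^ 4 * |P.conBar j (s.x k)| := by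
  have hV : 0 ≤ V := zero_le_one.trans hr.one_le
  have hVV : V ≤ V ^ 2 := le_self_pow₀ hr.one_le two_ne_zero
  have hg : |inner ℝ (P.g j (s.x k)) (s.d₀ k)| ≤ V ^ 2 := by
    rw [sq]
    exact (abs_real_inner_le_norm _ _).trans
      (mul_le_mul (hr.norm_g_le j k) (hr.norm_d₀_le k) (norm_nonneg _) hV)
  have hfactor : |P.conBar j (s.x k) + inner ℝ (P.g j (s.x k)) (s.d₀ k)| + ‖s.d₀ k‖ ≤
      3 * V ^ 2 := by
    linarith [abs_add_le (P.conBar j (s.x k)) (inner ℝ (P.g j (s.x k)) (s.d₀ k)),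
      hr.abs_conBar_le j k, hr.norm_d₀_le k]
  have hht : s.ht k j ≤ 2 * V ^ 2 := calc
    s.ht k j ≤ ‖s.ht k‖ := (Real.le_norm_self _).trans (norm_le_pi_norm _ j)
    _ ≤ V * (2 * V) := (hr.norm_ht_le k).trans (by gcongr; exact hr.residual_le k)
    _ = 2 * V ^ 2 := by ring
  calc P.diagD (s.x k) (s.d₀ k) j * s.ht k j
    _ ≤ |P.conBar j (s.x k)| * (3 * V ^ 2) * (2 * V ^ 2) := by
      refine mul_le_mul_of_nonneg ?_ hht (P.diagD_nonneg _ _ j) (by positivity)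
      exact mul_le_mul_of_nonneg_left hfactor (abs_nonneg _)
    _ = 6 * V ^ 4 * |P.conBar j (s.x k)| := by ring

theorem inner_con_q_le (hr : RunBounds P p s a V) (hs : IsGenerated P p s) (j : Fin m) (k : ℕ) :
    inner ℝ (P.g j (s.x k)) (s.q k) ≤
      (1 + 6 * V ^ 4) * |P.conBar j (s.x k)| - weight P p s k * residual P p s k := by
  have hd₀ : inner ℝ (P.g j (s.x k)) (s.d₀ k) ≤ |P.conBar j (s.x k)| := by
    linarith [(hs.qp_solution k).1 j, neg_abs_le (P.conBar j (s.x k))]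
  have hdt : inner ℝ (P.g j (s.x k)) (s.dt k) ≤
      6 * V ^ 4 * |P.conBar j (s.x k)| - residual P p s k := by
    unfold residual
    linarith [(hs.updated k).2 j, hr.diagD_mul_ht_le j k]
  have hw₀ : 0 ≤ weight P p s k := hr.weight_nonneg k
  have hw₁ : weight P p s k ≤ 1 := beta_le_one
  have hbar : weight P p s k * (6 * V ^ 4 * |P.conBar j (s.x k)|) ≤
      6 * V ^ 4 * |P.conBar j (s.x k)| := mul_le_of_le_one_left (by positivity) hw₁
  have hwbar : 0 ≤ weight P p s k * |P.conBar j (s.x k)| := by positivity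
  calc inner ℝ (P.g j (s.x k)) (s.q k)
    _ = (1 - weight P p s k) * inner ℝ (P.g j (s.x k)) (s.d₀ k) +
        weight P p s k * inner ℝ (P.g j (s.x k)) (s.dt k) := by
      rw [hs.combination k, inner_add_right, inner_smul_right, inner_smul_right]
      rfl
    _ ≤ (1 - weight P p s k) * |P.conBar j (s.x k)| +
        weight P p s k * (6 * V ^ 4 * |P.conBar j (s.x k)| - residual P p s k) :=
      add_le_add (mul_le_mul_of_nonneg_left hd₀ (sub_nonneg.2 hw₁))
        (mul_le_mul_of_nonneg_left hdt hw₀)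
    _ ≤ (1 + 6 * V ^ 4) * |P.conBar j (s.x k)| - weight P p s k * residual P p s k := by
      linarith

theorem taylor_term_le (hr : RunBounds P p s a V) (hs : IsGenerated P p s) (k : ℕ) {t Y : ℝ}
    (ht : 0 ≤ t) (htY : t * (V * (1 + V) ^ 2) ≤ Y) :
    V * t ^ 2 * ‖s.q k‖ ^ 2 ≤ t * (Y * residual P p s k ^ 2) := by
  have hV : 0 ≤ V := zero_le_one.trans hr.one_le
  calc V * t ^ 2 * ‖s.q k‖ ^ 2
    _ ≤ V * t ^ 2 * ((1 + V) * residual P p s k) ^ 2 := by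
      gcongr
      exact hr.norm_q_le hs k
    _ = t * (t * (V * (1 + V) ^ 2) * residual P p s k ^ 2) := by ring
    _ ≤ t * (Y * residual P p s k ^ 2) := by gcongr

theorem eventually_forall_con_le (hr : RunBounds P p s a V) (hs : IsGenerated P p s) :
    ∀ᶠ t in 𝓝[>] 0, ∀ j k, P.con j (s.x k + t • s.q k) ≤
      P.con j (s.x k) - P.conBar j (s.x k) - p.γ * t * (weight P p s k * residual P p s k) := by
  obtain ⟨c, hc, hweight⟩ := hr.exists_le_weight_mul
  have hγ : 0 < 1 - p.γ := sub_pos.2 p.γ_lt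
  filter_upwards [self_mem_nhdsWithin, eventually_mul_le 1 one_pos,
    eventually_mul_le (1 + 6 * V ^ 4) one_pos, eventually_mul_le (V * (1 + V) ^ 2) (mul_pos hγ hc)]
    with t ht₀ ht₁ htbar htq j k
  have ht₀ : 0 ≤ t := le_of_lt ht₀
  have htaylor := (abs_le.1 (hr.taylor_con j k t ⟨ht₀, by linarith⟩)).2
  have hinner := mul_le_mul_of_nonneg_left (hr.inner_con_q_le hs j k) ht₀
  have hbar := mul_le_mul_of_nonneg_right htbar (abs_nonneg (P.conBar j (s.x k)))
  have hcurv : V * t ^ 2 * ‖s.q k‖ ^ 2 ≤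
      (1 - p.γ) * t * (weight P p s k * residual P p s k) := calc
    V * t ^ 2 * ‖s.q k‖ ^ 2
    _ ≤ t * ((1 - p.γ) * c * residual P p s k ^ 2) := hr.taylor_term_le hs k ht₀ htq
    _ = (1 - p.γ) * t * (c * residual P p s k ^ 2) := by ring
    _ ≤ (1 - p.γ) * t * (weight P p s k * residual P p s k) := by
      refine mul_le_mul_of_nonneg_left (le_trans ?_ (hweight k)) (mul_nonneg hγ.le ht₀)
      gcongr
      exact le_add_of_nonneg_right (P.rpow_phi_nonneg _ _)
  linarith [abs_of_nonpos (P.conBar_nonpos j (s.x k))]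

theorem eventually_forall_obj_le (hr : RunBounds P p s a V) (hs : IsGenerated P p s) :
    ∀ᶠ t in 𝓝[>] 0, ∀ k, P.obj (s.x k + t • s.q k) ≤
      P.obj (s.x k) + p.γ * t * inner ℝ (P.g₀ (s.x k)) (s.q k) +
        p.ρ * (1 - p.γ) * t * P.phi (s.x k) ^ p.θ := by
  have hV := zero_lt_one.trans_le hr.one_le
  have hγ : 0 < 1 - p.γ := sub_pos.2 p.γ_lt
  set e := min (p.θ * a) (p.ρ - 1)
  have he : 0 < e := lt_min (mul_pos p.θ_pos hr.a_pos) (sub_pos.2 p.ρ_gt)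
  filter_upwards [self_mem_nhdsWithin, eventually_mul_le 1 one_pos,
    eventually_mul_le (V * (1 + V) ^ 2) (Y := (1 - p.γ) * e / (2 * V ^ 2)) (by positivity)]
    with t ht₀ ht₁ htq k
  have ht₀ : 0 ≤ t := le_of_lt ht₀
  have hφ := P.rpow_phi_nonneg (s.x k) p.θ
  have htaylor := (abs_le.1 (hr.taylor_obj k t ⟨ht₀, by linarith⟩)).2
  have hcurv : V * t ^ 2 * ‖s.q k‖ ^ 2 ≤
      t * ((1 - p.γ) * (p.θ * a * ‖s.d₀ k‖ ^ 2 + (p.ρ - 1) * P.phi (s.x k) ^ p.θ)) := calc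
    V * t ^ 2 * ‖s.q k‖ ^ 2
    _ ≤ t * ((1 - p.γ) * e / (2 * V ^ 2) * residual P p s k ^ 2) :=
      hr.taylor_term_le hs k ht₀ htq
    _ ≤ t * ((1 - p.γ) * e / (2 * V ^ 2) *
        (2 * V ^ 2 * (‖s.d₀ k‖ ^ 2 + P.phi (s.x k) ^ p.θ))) := by
      gcongr
      exact hr.sq_residual_le k
    _ = t * ((1 - p.γ) * (e * ‖s.d₀ k‖ ^ 2 + e * P.phi (s.x k) ^ p.θ)) := by field_simp
    _ ≤ t * ((1 - p.γ) * (p.θ * a * ‖s.d₀ k‖ ^ 2 + (p.ρ - 1) * P.phi (s.x k) ^ p.θ)) := by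
      gcongr
      exacts [min_le_left _ _, min_le_right _ _]
  have hinner := mul_le_mul_of_nonneg_left (hr.inner_q_le hs k) (mul_nonneg ht₀ hγ.le)
  linarith

theorem eventually_forall_stepTestII (hr : RunBounds P p s a V) (hs : IsGenerated P p s) :
    ∀ᶠ t in 𝓝[>] 0, ∀ k,
      StepTestII P p (s.x k) (s.d₀ k) (s.q k) (weight P p s k) t := by
  filter_upwards [self_mem_nhdsWithin, hr.eventually_forall_obj_le hs,
    hr.eventually_forall_con_le hs] with t ht hobj hcon k
  refine ⟨hobj k, fun j hj => (hcon j k).trans_eq ?_, fun j hj => (hcon j k).trans ?_⟩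
  · rw [P.conBar_eq_sub_phi hj, residual]
    ring
  · rw [P.conBar_eq_con hj, sub_self, zero_sub, neg_nonpos]
    exact mul_nonneg (mul_nonneg p.γ_pos.le (le_of_lt ht))
      (mul_nonneg (hr.weight_nonneg k) (residual_nonneg k))

theorem exists_le_t (hr : RunBounds P p s a V) (hs : IsGenerated P p s) :
    ∃ tb > 0, ∀ k, tb ≤ s.t k := by
  obtain ⟨tb, htb, htest⟩ :=
    mem_nhdsGT_iff_exists_Ioc_subset.1 (hr.eventually_forall_stepTestII hs)
  have htb : 0 < tb := htb
  have hη := p.η_pos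
  have hε := p.ε_pos
  refine ⟨min p.ε (min 1 (p.η * tb)), by positivity, fun k => ?_⟩
  rcases hs.search k with ⟨⟨-, i, -, hεt, -⟩, -⟩ | ⟨-, ⟨i, hi, -, hfail⟩, -⟩
  · exact (min_le_left _ _).trans hεt
  refine (min_le_right _ _).trans ?_
  rw [hi]
  rcases i with _ | i
  · exact (min_le_left _ _).trans_eq (pow_zero _).symm
  · have hlt : tb < p.η ^ i := by
      by_contra! hle
      exact hfail i i.lt_succ_self (htest ⟨by positivity, hle⟩ k)
    refine (min_le_right _ _).trans ?_
    rw [pow_succ']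
    gcongr

end RunBounds

end LineSearch

section Convergence

variable {n m : ℕ} {P : Problem n m} {p : Params} {s : Sequences n m} {a V : ℝ}

theorem IsGenerated.stepTestI_or_stepTestII (hs : IsGenerated P p s) (k : ℕ) :
    StepTestI P p (s.x k) (s.d₀ k) (s.d k) (s.t k) ∨
      StepTestII P p (s.x k) (s.d₀ k) (s.q k) (weight P p s k) (s.t k) ∧ s.d k = s.q k := by
  rcases hs.search k with ⟨⟨-, _, -, -, htest, -⟩, hd⟩ | ⟨-, ⟨_, -, htest, -⟩, hd⟩
  · exact .inl (hd ▸ htest)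
  · exact .inr ⟨htest, hd⟩

theorem IsGenerated.t_le_one (hs : IsGenerated P p s) (k : ℕ) : s.t k ≤ 1 := by
  rcases hs.search k with ⟨⟨-, _, ht, -⟩, -⟩ | ⟨-, ⟨_, ht, -⟩, -⟩ <;> rw [ht]
  · exact pow_le_one₀ (by norm_num) (by norm_num)
  · exact pow_le_one₀ p.η_pos.le p.η_lt.le

theorem IsGenerated.con_succ_nonpos (hs : IsGenerated P p s) {j : Fin m} {k : ℕ}
    (hj : P.con j (s.x k) ≤ 0) : P.con j (s.x (k + 1)) ≤ 0 := by
  rw [hs.step k]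
  rcases hs.stepTestI_or_stepTestII k with ⟨-, -, hcon⟩ | ⟨⟨-, -, hcon⟩, hd⟩
  · exact hcon j hj
  · exact hd ▸ hcon j hj

namespace RunBounds

theorem exists_con_succ_le (hr : RunBounds P p s a V) (hs : IsGenerated P p s) :
    ∃ c > 0, ∀ j k, 0 < P.con j (s.x k) →
      P.con j (s.x (k + 1)) ≤ P.phi (s.x k) - c * P.phi (s.x k) ^ p.σ := by
  obtain ⟨tb, htb, ht⟩ := hr.exists_le_t hs
  obtain ⟨c, hc, hweight⟩ := hr.exists_le_weight_mul
  have hα := p.α_pos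
  have hγ := p.γ_pos
  refine ⟨min (p.α * tb) (p.γ * tb * c), by positivity, fun j k hj => ?_⟩
  have hφ := P.rpow_phi_nonneg (s.x k) p.σ
  have htk : tb ≤ s.t k := ht k
  have htk₀ : 0 ≤ s.t k := htb.le.trans htk
  rw [hs.step k]
  rcases hs.stepTestI_or_stepTestII k with ⟨-, hcon, -⟩ | ⟨⟨-, hcon, -⟩, hd⟩
  · refine (hcon j hj).trans (sub_le_sub_left ?_ _)
    have hle : P.phi (s.x k) ^ p.σ ≤ ‖s.d₀ k‖ ^ p.τ + P.phi (s.x k) ^ p.σ :=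
      le_add_of_nonneg_left (by positivity)
    gcongr
    exact (min_le_left _ _).trans (by gcongr)
  · rw [hd]
    refine (hcon j hj).trans (sub_le_sub_left ?_ _)
    have hle : c * P.phi (s.x k) ^ p.σ ≤ weight P p s k * residual P p s k := by
      refine le_trans ?_ (hweight k)
      gcongr
      exact le_add_of_nonneg_left (sq_nonneg _)
    calc min (p.α * tb) (p.γ * tb * c) * P.phi (s.x k) ^ p.σ
      _ ≤ p.γ * tb * c * P.phi (s.x k) ^ p.σ := by
        gcongr
        exact min_le_right _ _
      _ = p.γ * tb * (c * P.phi (s.x k) ^ p.σ) := by ring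
      _ ≤ p.γ * s.t k * (weight P p s k * residual P p s k) := by gcongr
      _ = p.γ * s.t k * weight P p s k * (‖s.d₀ k‖ + P.phi (s.x k) ^ p.σ) := by
        rw [← mul_assoc, residual]

theorem eventually_phi_eq_zero (hr : RunBounds P p s a V) (hs : IsGenerated P p s) :
    ∀ᶠ k in atTop, P.phi (s.x k) = 0 := by
  obtain ⟨c, hc, hcon⟩ := hr.exists_con_succ_le hs
  refine eventually_eq_zero_of_le_max_sub hc p.σ_pos.le p.σ_lt (fun k => P.phi_nonneg _)
    fun k => P.phi_le_iff.2 ⟨le_max_left _ _, fun j => ?_⟩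
  rcases le_or_gt (P.con j (s.x k)) 0 with hj | hj
  · exact (hs.con_succ_nonpos hj).trans (le_max_left _ _)
  · exact (hcon j k hj).trans (le_max_right _ _)

theorem exists_obj_succ_le (hr : RunBounds P p s a V) (hs : IsGenerated P p s) :
    ∃ c > 0, ∀ k, P.phi (s.x k) = 0 →
      P.obj (s.x (k + 1)) ≤ P.obj (s.x k) - c * ‖s.d₀ k‖ ^ 2 := by
  obtain ⟨tb, htb, ht⟩ := hr.exists_le_t hs
  have ha := hr.a_pos
  have hα := p.α_pos
  have hγ := p.γ_pos
  have hθ := p.θ_pos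
  set c := min (p.α * tb * a) (p.γ * tb * (p.θ * a))
  refine ⟨c, by positivity, fun k hk => ?_⟩
  have hφ : P.phi (s.x k) ^ p.θ = 0 := by rw [hk, Real.zero_rpow hθ.ne']
  have htk : tb ≤ s.t k := ht k
  have htk₀ : 0 ≤ s.t k := htb.le.trans htk
  rw [hs.step k]
  rcases hs.stepTestI_or_stepTestII k with ⟨hobj, -⟩ | ⟨⟨hobj, -⟩, hd⟩
  · have hinner := mul_le_mul_of_nonneg_left (hr.descent k) (mul_nonneg hα.le htk₀)
    have hc : c * ‖s.d₀ k‖ ^ 2 ≤ p.α * s.t k * a * ‖s.d₀ k‖ ^ 2 := by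
      gcongr
      exact (min_le_left _ _).trans (by gcongr)
    rw [hφ] at hobj
    linarith
  · have hinner := mul_le_mul_of_nonneg_left (hr.inner_q_le hs k) (mul_nonneg hγ.le htk₀)
    have hc : c * ‖s.d₀ k‖ ^ 2 ≤ p.γ * s.t k * (p.θ * a) * ‖s.d₀ k‖ ^ 2 := by
      gcongr
      exact (min_le_right _ _).trans (by gcongr)
    rw [hφ] at hobj hinner
    rw [hd]
    linarith

theorem tendsto_d₀ (hr : RunBounds P p s a V) (hs : IsGenerated P p s)
    (hobj : Continuous P.obj) (hbdd : Bornology.IsBounded (Set.range s.x)) :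
    Tendsto s.d₀ atTop (𝓝 0) := by
  obtain ⟨c, hc, hdecr⟩ := hr.exists_obj_succ_le hs
  obtain ⟨R, hR⟩ := (eventually_forall_norm_le hobj hbdd).exists
  have hbelow : BddBelow (Set.range fun k => P.obj (s.x k)) :=
    ⟨-R, Set.forall_mem_range.2 fun k => (abs_le.1 (hR k)).1⟩
  have hsq : Tendsto (fun k => c * ‖s.d₀ k‖ ^ 2) atTop (𝓝 0) :=
    tendsto_zero_of_succ_le_sub hbelow (fun k => by positivity)
      ((hr.eventually_phi_eq_zero hs).mono hdecr)
  refine tendsto_zero_iff_norm_tendsto_zero.2 ?_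
  simpa [hc.ne'] using (hsq.const_mul c⁻¹).sqrt

theorem tendsto_phi (hr : RunBounds P p s a V) (hs : IsGenerated P p s) :
    Tendsto (fun k => P.phi (s.x k)) atTop (𝓝 0) :=
  tendsto_const_nhds.congr' (EventuallyEq.symm (hr.eventually_phi_eq_zero hs))

theorem tendsto_rpow_phi (hr : RunBounds P p s a V) (hs : IsGenerated P p s) :
    Tendsto (fun k => P.phi (s.x k) ^ p.σ) atTop (𝓝 0) := by
  simpa only [Real.zero_rpow p.σ_pos.ne'] using
    (hr.tendsto_phi hs).rpow_const (p := p.σ) (.inr p.σ_pos.le)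

theorem tendsto_residual (hr : RunBounds P p s a V) (hs : IsGenerated P p s)
    (hd₀ : Tendsto s.d₀ atTop (𝓝 0)) : Tendsto (residual P p s) atTop (𝓝 0) := by
  have h := hd₀.norm.add (hr.tendsto_rpow_phi hs)
  rwa [norm_zero, add_zero] at h

theorem tendsto_dt (hr : RunBounds P p s a V) (hs : IsGenerated P p s)
    (hd₀ : Tendsto s.d₀ atTop (𝓝 0)) : Tendsto s.dt atTop (𝓝 0) :=
  squeeze_zero_norm hr.norm_dt_le
    (by simpa only [mul_zero] using (hr.tendsto_residual hs hd₀).const_mul V)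

theorem tendsto_q (hr : RunBounds P p s a V) (hs : IsGenerated P p s)
    (hd₀ : Tendsto s.d₀ atTop (𝓝 0)) : Tendsto s.q atTop (𝓝 0) :=
  squeeze_zero_norm (hr.norm_q_le hs)
    (by simpa only [mul_zero] using (hr.tendsto_residual hs hd₀).const_mul (1 + V))

theorem tendsto_d₁ (hr : RunBounds P p s a V) (hs : IsGenerated P p s)
    (hd₀ : Tendsto s.d₀ atTop (𝓝 0)) : Tendsto s.d₁ atTop (𝓝 0) := by
  have hτ : 0 < p.τ := two_pos.trans p.τ_gt
  have h := (((hd₀.norm.rpow_const (p := p.τ) (.inr hτ.le)).add (hr.tendsto_rpow_phi hs)).add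
    ((hd₀.norm.pow 2).const_mul V)).const_mul V
  refine squeeze_zero_norm hr.norm_d₁_le ?_
  simpa [Real.zero_rpow hτ.ne'] using h

theorem tendsto_d (hr : RunBounds P p s a V) (hs : IsGenerated P p s)
    (hd₀ : Tendsto s.d₀ atTop (𝓝 0)) : Tendsto s.d atTop (𝓝 0) := by
  have h := (hd₀.add (hr.tendsto_d₁ hs hd₀)).norm.add (hr.tendsto_q hs hd₀).norm
  simp only [add_zero, norm_zero] at h
  refine squeeze_zero_norm (fun k => ?_) h
  rcases hs.search k with ⟨-, hd⟩ | ⟨-, -, hd⟩ <;> rw [hd]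
  · exact le_add_of_nonneg_right (norm_nonneg _)
  · exact le_add_of_nonneg_left (norm_nonneg _)

theorem tendsto_norm_step (hr : RunBounds P p s a V) (hs : IsGenerated P p s)
    (hd₀ : Tendsto s.d₀ atTop (𝓝 0)) :
    Tendsto (fun k => ‖s.x (k + 1) - s.x k‖) atTop (𝓝 0) := by
  obtain ⟨tb, htb, ht⟩ := hr.exists_le_t hs
  refine squeeze_zero (fun k => norm_nonneg _) (fun k => ?_)
    (tendsto_zero_iff_norm_tendsto_zero.1 (hr.tendsto_d hs hd₀))
  rw [hs.step k, add_sub_cancel_left, norm_smul, Real.norm_of_nonneg (htb.le.trans (ht k))]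
  exact mul_le_of_le_one_left (norm_nonneg _) (hs.t_le_one k)

end RunBounds

namespace IsGenerated

theorem asymptoticKKT (hs : IsGenerated P p s) (hB : UniformlyPosDef s.B)
    (hφ : ∀ᶠ k in atTop, P.phi (s.x k) = 0) (hd₀ : Tendsto s.d₀ atTop (𝓝 0)) {l : Filter ℕ}
    (hl : l ≤ atTop) {y : E n} (hy : Tendsto s.x l (𝓝 y)) :
    P.AsymptoticKKT l s.x s.d₀ s.lam y := by
  obtain ⟨a, -, b, -, hab⟩ := hB.exists_isFormBounded hs.posDef
  have hBd₀ : Tendsto (fun k => -(s.B k).toEuclideanLin (s.d₀ k)) atTop (𝓝 0) :=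
    squeeze_zero_norm (fun k => (norm_neg _).trans_le (hab k (s.d₀ k)).2)
      (by simpa only [norm_zero, mul_zero] using hd₀.norm.const_mul b)
  have hfeas : ∀ᶠ k in l, ∀ j, P.con j (s.x k) ≤ 0 :=
    hl (hφ.mono fun _ h => P.phi_eq_zero_iff.1 h)
  refine ⟨hy, hd₀.mono_left hl, (hBd₀.mono_left hl).congr fun k => ?_, hfeas,
    .of_forall fun k => (hs.qp_multiplier k).nonneg, hfeas.mono fun k hk j => ?_⟩
  · rw [neg_eq_iff_add_eq_zero, ← (hs.qp_multiplier k).stationary]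
    abel
  · rw [← P.conBar_eq_con (hk j)]
    exact (hs.qp_multiplier k).complementary j

theorem exists_isKKTPair_of_mapClusterPt (hs : IsGenerated P p s) (hobj : ContDiff ℝ 1 P.obj)
    (hcon : ∀ j, ContDiff ℝ 1 (P.con j)) (hind : P.GradientsIndependent)
    (hB : UniformlyPosDef s.B) (hφ : ∀ᶠ k in atTop, P.phi (s.x k) = 0)
    (hd₀ : Tendsto s.d₀ atTop (𝓝 0)) {y : E n} (hy : MapClusterPt y atTop s.x) :
    ∃ lam, P.IsKKTPair y lam := by
  obtain ⟨U, hU, hUy⟩ := mapClusterPt_iff_ultrafilter.1 hy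
  exact (hs.asymptoticKKT hB hφ hd₀ hU hUy).exists_isKKTPair hobj hcon (hind y)

end IsGenerated

end Convergence

end SubfeasibleSQP

theorem theorem2_general {n m : ℕ} (P : SubfeasibleSQP.Problem n m)
    (p : SubfeasibleSQP.Params) (s : SubfeasibleSQP.Sequences n m)
    (hobj : ContDiff ℝ 2 P.obj) (hcon : ∀ j, ContDiff ℝ 2 (P.con j))
    (hind : P.GradientsIndependent)
    (hs : SubfeasibleSQP.IsGenerated P p s)
    (hB : SubfeasibleSQP.UniformlyPosDef s.B)
    (hbdd : Bornology.IsBounded (Set.range s.x))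
    (xs : SubfeasibleSQP.E n) (hxs : MapClusterPt xs atTop s.x)
    (hsosc : ∀ lam, P.IsKKTPair xs lam → P.SOSC xs lam) :
    (Tendsto s.d₀ atTop (𝓝 0) ∧ Tendsto s.d₁ atTop (𝓝 0) ∧ Tendsto s.dt atTop (𝓝 0) ∧
      Tendsto s.q atTop (𝓝 0) ∧ Tendsto s.d atTop (𝓝 0) ∧
      Tendsto (fun k => ‖s.x (k + 1) - s.x k‖) atTop (𝓝 0)) ∧
    Tendsto s.x atTop (𝓝 xs) ∧
    (Tendsto (fun k => P.phi (s.x k)) atTop (𝓝 (P.phi xs)) ∧ P.phi xs = 0) ∧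
    ∃ lams : Fin m → ℝ, P.IsKKTPair xs lams ∧ (∀ lam, P.IsKKTPair xs lam → lam = lams) ∧
      Tendsto s.lam atTop (𝓝 lams) := by
  have hobj₁ : ContDiff ℝ 1 P.obj := hobj.of_le one_le_two
  have hcon₁ : ∀ j, ContDiff ℝ 1 (P.con j) := fun j => (hcon j).of_le one_le_two
  obtain ⟨a, V, hr⟩ := hs.exists_runBounds hobj hcon hind hB hbdd
  have hd₀ := hr.tendsto_d₀ hs hobj.continuous hbdd
  have hφ := hr.eventually_phi_eq_zero hs
  have hstep := hr.tendsto_norm_step hs hd₀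
  have hcluster : ∀ y, MapClusterPt y atTop s.x → ∃ lam, P.IsKKTPair y lam :=
    fun y => hs.exists_isKKTPair_of_mapClusterPt hobj₁ hcon₁ hind hB hφ hd₀
  obtain ⟨lams, hlams⟩ := hcluster xs hxs
  have hx : Tendsto s.x atTop (𝓝 xs) :=
    SubfeasibleSQP.tendsto_of_isolated_mapClusterPt (by simpa only [dist_eq_norm] using hstep) hxs
      (((hsosc lams hlams).eventually_not_isKKTPair hobj hcon (hind xs) hlams).mono
        fun y hy => mt (hcluster y) hy)
  have hφxs : P.phi xs = 0 := P.phi_eq_zero_iff.2 hlams.feasible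
  exact ⟨⟨hd₀, hr.tendsto_d₁ hs hd₀, hr.tendsto_dt hs hd₀, hr.tendsto_q hs hd₀,
      hr.tendsto_d hs hd₀, hstep⟩, hx, ⟨hφxs ▸ hr.tendsto_phi hs, hφxs⟩, lams, hlams,
    fun lam hlam => hlam.unique hobj₁ hcon₁ (hind xs) hlams,
    (hs.asymptoticKKT hB hφ hd₀ le_rfl hx).tendsto_multiplier hobj₁ hcon₁ (hind xs) hlams⟩

theorem theorem2 {n m : ℕ} (P : SubfeasibleSQP.Problem n m)
    (p : SubfeasibleSQP.Params) (s : SubfeasibleSQP.Sequences n m)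
    (hobj : ContDiff ℝ 2 P.obj) (hcon : ∀ j, ContDiff ℝ 2 (P.con j))
    (hind : P.GradientsIndependent)
    (hs : SubfeasibleSQP.IsGenerated P p s)
    (hB : SubfeasibleSQP.UniformlyPosDef s.B)
    (hbdd : Bornology.IsBounded (Set.range s.x))
    (xs : SubfeasibleSQP.E n) (hxs : MapClusterPt xs atTop s.x)
    (hssosc : ∀ lam, P.IsKKTPair xs lam → P.SSOSC xs lam) :
    (Tendsto s.d₀ atTop (𝓝 0) ∧ Tendsto s.d₁ atTop (𝓝 0) ∧ Tendsto s.dt atTop (𝓝 0) ∧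
      Tendsto s.q atTop (𝓝 0) ∧ Tendsto s.d atTop (𝓝 0) ∧
      Tendsto (fun k => ‖s.x (k + 1) - s.x k‖) atTop (𝓝 0)) ∧
    Tendsto s.x atTop (𝓝 xs) ∧
    (Tendsto (fun k => P.phi (s.x k)) atTop (𝓝 (P.phi xs)) ∧ P.phi xs = 0) ∧
    ∃ lams : Fin m → ℝ, P.IsKKTPair xs lams ∧ (∀ lam, P.IsKKTPair xs lam → lam = lams) ∧
      Tendsto s.lam atTop (𝓝 lams) :=
  theorem2_general P p s hobj hcon hind hs hB hbdd xs hxs fun lam hlam => (hssosc lam hlam).sosc
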